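/- Let $\mathbb T\subseteq\mathbb R$ be a time scale (a nonempty closed set), with forward jump $\sigma(t)=\inf\{s\in\mathbb T: s>t\}$, graininess $\mu(t)=\sigma(t)-t$ and delta derivative $\Delta$. A point $t\in\mathbb T$ is right-dense if $\sigma(t)=t$. Let $T>0$ and suppose that $\mathbb T$ is $T$-periodic: $t+T\in\mathbb T$ and $\mu(t+T)=\mu(t)$ for all $t\in\mathbb T$ (so $\mathbb T$ is unbounded above). Let $p,q:\mathbb T\to\mathbb R$ be rd-continuous and $T$-periodic with $1-\mu(t)p(t)+\mu(t)^2q(t)\neq0$ and $q(t)\ne0$ for all $t\in\mathbb T$, and $q(t)>0$ at every right-dense $t$; suppose also that there is a delta differentiable function $\phi:\mathbb T\to\mathbb R$ with rd-continuous delta derivative and $\phi(\sigma(t))\phi(t)=q(t)$ for all $t\in\mathbb T$. Consider $$x^{\Delta\Delta}+p(t)x^{\Delta}+q(t)x=0.\tag{1}$$ Equation (1) is called stable if for every $s\in\mathbb T$ and $\varepsilon>0$ there is $\delta>0$ such that every solution of (1) with $|x(s)|<\delta$ and $|x^\Delta(s)|<\delta$ satisfies $|x(t)|<\varepsilon$ and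 $|x^\Delta(t)|<\varepsilon$ for all $t\in\mathbb T$ with $t\ge s$; it is called unstable otherwise. Fix $t_0\in\mathbb T$ and let $Y$ be the $2\times2$ matrix solution on $\mathbb T$ of $Y^\Delta=S(t)Y$, $Y(t_0)=I$, where $S=\begin{pmatrix}0&1\\-q&-p\end{pmatrix}$. Put $\mathcal A=\operatorname{tr}Y(t_0+T)$ and $\mathcal B=e_{-p+\mu q}(t_0+T,t_0)$, where $e_r(t,s)=\exp\left(\int_s^t\xi_{\mu(\tau)}(r(\tau))\,\Delta\tau\right)$ is the exponential function of the time scale, with $\xi_h(z)=\operatorname{Log}(1+zh)/h$ for $h>0$ and $\xi_0(z)=z$. The multipliers of (1) are the (complex) eigenvalues of $Y(t_0+T)$. Assume that $\mathcal B=1$. (i) If $|\mathcal A|<2$, then equation (1) is stable, and it has two distinct multipliers, both of modulus $1$. (ii) If $|\mathcal A|>2$, then equation (1) is unstable. -/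

import Mathlib

namespace TimeScale

/-- A time scale: a nonempty closed subset of the real line. -/
structure IsTimeScale (𝕋 : Set ℝ) : Prop where
  nonempty : 𝕋.Nonempty
  isClosed : IsClosed 𝕋

open Classical in
/-- The forward jump operator `σ(t) = inf {s ∈ 𝕋 : s > t}`, with `inf ∅ = sup 𝕋`. -/
noncomputable def sigma (𝕋 : Set ℝ) (t : ℝ) : ℝ :=
  if (𝕋 ∩ Set.Ioi t).Nonempty then sInf (𝕋 ∩ Set.Ioi t) else sSup 𝕋

open Classical in
/-- The backward jump operator `ρ(t) = sup {s ∈ 𝕋 : s < t}`, with `sup ∅ = inf 𝕋`. -/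
noncomputable def backJump (𝕋 : Set ℝ) (t : ℝ) : ℝ :=
  if (𝕋 ∩ Set.Iio t).Nonempty then sSup (𝕋 ∩ Set.Iio t) else sInf 𝕋

/-- The graininess function `μ(t) = σ(t) - t`. -/
noncomputable def graininess (𝕋 : Set ℝ) (t : ℝ) : ℝ := sigma 𝕋 t - t

def RightDense (𝕋 : Set ℝ) (t : ℝ) : Prop := sigma 𝕋 t = t

def LeftDense (𝕋 : Set ℝ) (t : ℝ) : Prop := backJump 𝕋 t = t

/-- `𝕋` is a `T`-periodic time scale. -/
structure IsPeriodic (𝕋 : Set ℝ) (T : ℝ) : Prop where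
  pos : 0 < T
  add_mem : ∀ t ∈ 𝕋, t + T ∈ 𝕋
  graininess_add : ∀ t ∈ 𝕋, graininess 𝕋 t = graininess 𝕋 (t + T)

/-- Functions on `𝕋` are represented by functions on `ℝ`, only whose values on `𝕋` matter.
`f` is rd-continuous on `𝕋`: continuous (relative to `𝕋`) at right-dense points, with finite
left-sided limits (within `𝕋`) at left-dense points. -/
def RdContinuous (𝕋 : Set ℝ) (f : ℝ → ℝ) : Prop :=
  (∀ t ∈ 𝕋, RightDense 𝕋 t → ContinuousWithinAt f 𝕋 t) ∧
  (∀ t ∈ 𝕋, LeftDense 𝕋 t → ∃ l : ℝ, Filter.Tendsto f (nhdsWithin t (𝕋 ∩ Set.Iio t)) (nhds l))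

/-- `f` is delta differentiable at `t` with delta derivative `f^Δ(t) = a`. -/
def HasDeltaDerivAt {E : Type*} [NormedAddCommGroup E] [NormedSpace ℝ E]
    (𝕋 : Set ℝ) (f : ℝ → E) (a : E) (t : ℝ) : Prop :=
  ∀ ε : ℝ, 0 < ε → ∃ δ : ℝ, 0 < δ ∧ ∀ s ∈ 𝕋, |s - t| < δ →
    ‖f (sigma 𝕋 t) - f s - (sigma 𝕋 t - s) • a‖ ≤ ε * |sigma 𝕋 t - s|

/-- `f` is delta differentiable on `𝕋` with rd-continuous delta derivative (for `𝕋` unbounded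
above). -/
def IsCrd1 (𝕋 : Set ℝ) (f : ℝ → ℝ) : Prop :=
  ∃ f' : ℝ → ℝ, (∀ t ∈ 𝕋, HasDeltaDerivAt 𝕋 f (f' t) t) ∧ RdContinuous 𝕋 f'

/-- `F` is a (delta) antiderivative of `f` on `𝕋` (for `𝕋` unbounded above). -/
def IsAntideriv (𝕋 : Set ℝ) (F f : ℝ → ℂ) : Prop :=
  ∀ t ∈ 𝕋, HasDeltaDerivAt 𝕋 F (f t) t

open Classical in
/-- The Cauchy delta integral `∫_a^b f(τ) Δτ = F(b) - F(a)`, where `F` is any antiderivative of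
`f` (junk value `0` when there is none; every rd-continuous function has one). -/
noncomputable def deltaIntegral (𝕋 : Set ℝ) (f : ℝ → ℂ) (a b : ℝ) : ℂ :=
  if h : ∃ F : ℝ → ℂ, IsAntideriv 𝕋 F f then h.choose b - h.choose a else 0

open Classical in
/-- The cylinder transformation `ξ_h(z) = lim_{s ↘ h} Log (1 + z s) / s`, that is,
`Log (1 + z h) / h` for `h > 0` and `z` for `h = 0`. -/
noncomputable def cylinder (h : ℝ) (z : ℂ) : ℂ :=
  if h = 0 then z else Complex.log (1 + z * (h : ℂ)) / (h : ℂ)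

/-- The exponential function `e_p(t, s) = exp (∫_s^t ξ_{μ(τ)}(p(τ)) Δτ)`. -/
noncomputable def expFun (𝕋 : Set ℝ) (p : ℝ → ℝ) (t s : ℝ) : ℂ :=
  Complex.exp (deltaIntegral 𝕋 (fun τ => cylinder (graininess 𝕋 τ) (p τ : ℂ)) s t)

/-- `Y` solves `Y^Δ = A(t) Y` on `𝕋`, `Y(t₀) = I`. -/
def IsPrincipalMatrix {n : ℕ} (𝕋 : Set ℝ) (A : ℝ → Matrix (Fin n) (Fin n) ℝ) (t₀ : ℝ)
    (Y : ℝ → Matrix (Fin n) (Fin n) ℝ) : Prop :=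
  Y t₀ = 1 ∧ ∀ t ∈ 𝕋, ∀ i j, HasDeltaDerivAt 𝕋 (fun s => Y s i j) ((A t * Y t) i j) t

open Classical in
/-- The transition matrix `Φ_A(t, t₀)`: the solution of `Y^Δ = A(t) Y`, `Y(t₀) = I` (it exists
and is unique on `𝕋` for `A` regressive and rd-continuous; junk value `0` if there is none). -/
noncomputable def transitionMatrix {n : ℕ} (𝕋 : Set ℝ) (A : ℝ → Matrix (Fin n) (Fin n) ℝ)
    (t t₀ : ℝ) : Matrix (Fin n) (Fin n) ℝ :=
  if h : ∃ Y, IsPrincipalMatrix 𝕋 A t₀ Y then h.choose t else 0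

/-- The coefficient matrix of the first order system for `(x, x^Δ)`. -/
def coeffMatrix (p q : ℝ → ℝ) (t : ℝ) : Matrix (Fin 2) (Fin 2) ℝ :=
  !![0, 1; -q t, -p t]

/-- `𝒜 = x(t₀ + T) + ȳ(t₀ + T)`: the sum of the diagonal entries of `Φ_S(t₀ + T, t₀)`. -/
noncomputable def calA (𝕋 : Set ℝ) (T : ℝ) (p q : ℝ → ℝ) (t₀ : ℝ) : ℝ :=
  transitionMatrix 𝕋 (coeffMatrix p q) (t₀ + T) t₀ 0 0 +
    transitionMatrix 𝕋 (coeffMatrix p q) (t₀ + T) t₀ 1 1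

/-- `ℬ = e_{-p+μq}(t₀ + T, t₀)`. -/
noncomputable def calB (𝕋 : Set ℝ) (T : ℝ) (p q : ℝ → ℝ) (t₀ : ℝ) : ℂ :=
  expFun 𝕋 (fun t => -p t + graininess 𝕋 t * q t) (t₀ + T) t₀

/-- The Floquet (characteristic) multipliers: the complex eigenvalues of the monodromy matrix
`Φ_S(t₀ + T, t₀)`. -/
noncomputable def multipliers (𝕋 : Set ℝ) (T : ℝ) (p q : ℝ → ℝ) (t₀ : ℝ) : Set ℂ :=
  spectrum ℂ ((transitionMatrix 𝕋 (coeffMatrix p q) (t₀ + T) t₀).map (fun r : ℝ => (r : ℂ)))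

/-- `x` is a solution on `𝕋` of `x^{ΔΔ} + p(t) x^Δ + q(t) x = 0`, with delta derivative
`x^Δ = y`. -/
def IsSolution (𝕋 : Set ℝ) (p q x y : ℝ → ℝ) : Prop :=
  ∀ t ∈ 𝕋, HasDeltaDerivAt 𝕋 x (y t) t ∧
    ∃ z : ℝ, HasDeltaDerivAt 𝕋 y z t ∧ z + p t * y t + q t * x t = 0

/-- Stability (in the sense of Lyapunov) of `x^{ΔΔ} + p(t) x^Δ + q(t) x = 0`, that is, of its zero
solution: for every initial time `s` and every `ε > 0` there is `δ > 0` such that a solution with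
`|x(s)|, |x^Δ(s)| < δ` satisfies `|x(t)|, |x^Δ(t)| < ε` for all later times. -/
def IsStable (𝕋 : Set ℝ) (p q : ℝ → ℝ) : Prop :=
  ∀ s ∈ 𝕋, ∀ ε : ℝ, 0 < ε → ∃ δ : ℝ, 0 < δ ∧ ∀ x y : ℝ → ℝ, IsSolution 𝕋 p q x y →
    |x s| < δ → |y s| < δ → ∀ t ∈ 𝕋, s ≤ t → |x t| < ε ∧ |y t| < ε

/-- The equation is unstable if it is not stable. -/
def IsUnstable (𝕋 : Set ℝ) (p q : ℝ → ℝ) : Prop := ¬ IsStable 𝕋 p q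

/-- The standing assumptions on the equation `x^{ΔΔ} + p(t) x^Δ + q(t) x = 0`: periodic,
rd-continuous and regressive coefficients, `q` nonvanishing, `q > 0` at right-dense points, and
solvability of `φ^σ φ = q` in `C_rd^1`. -/
structure Admissible (𝕋 : Set ℝ) (T : ℝ) (p q : ℝ → ℝ) : Prop where
  periodic_p : ∀ t ∈ 𝕋, p (t + T) = p t
  periodic_q : ∀ t ∈ 𝕋, q (t + T) = q t
  rdContinuous_p : RdContinuous 𝕋 p
  rdContinuous_q : RdContinuous 𝕋 q
  regressive : ∀ t ∈ 𝕋, 1 - graininess 𝕋 t * p t + graininess 𝕋 t ^ 2 * q t ≠ 0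
  q_ne_zero : ∀ t ∈ 𝕋, q t ≠ 0
  q_pos : ∀ t ∈ 𝕋, RightDense 𝕋 t → 0 < q t
  exists_phi : ∃ φ : ℝ → ℝ, IsCrd1 𝕋 φ ∧ ∀ t ∈ 𝕋, φ (sigma 𝕋 t) * φ t = q t

end TimeScale

/-!
The state vector `(x, x^Δ)` of a solution satisfies the first order system `V^Δ = S V`, so
everything is governed by the principal matrix `Y` and the monodromy matrix `M = Y(t₀ + T)`.

The determinant of `Y` solves the scalar equation `u^Δ = (-p + μ q) u`, which the exponential
function `e_{-p+μq}` solves as well; uniqueness gives Liouville's formula (`ofReal_det_eq`), and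
`ℬ = 1` says that `det M = 1`. Translating a solution by the period gives a solution, so uniqueness
yields `Y(t + nT) = Y(t) Mⁿ` (`IsLinearSolution.floquet_nat`). Every point of `𝕋` above `s` is a
point of `[s, s + T]` translated by a multiple of `T`, so stability is equivalent to boundedness of
the powers of `M` (`isStable_of_bounded`, `IsStable.exists_bound_pow`).

By Cayley–Hamilton, `M^(n+2) = 𝒜 M^(n+1) - Mⁿ`. If `|𝒜| < 2`, each entry of `Mⁿ` keeps the
positive definite form `x² - 𝒜 x y + y²` of consecutive terms invariant, hence is bounded
(`exists_bound_of_recurrence`); the eigenvalues are the two nonreal conjugate roots of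
`z² - 𝒜 z + 1`. If `|𝒜| > 2`, the trace of `Mⁿ` grows at least like `(|𝒜| - 1)ⁿ`
(`not_bounded_of_recurrence`).

What this rests on is the theory of linear equations on a time scale. A delta integral is an
ordinary integral of the integrand composed with the map sending `s` to the last point of `𝕋` before
it (`RdRegular.hasDeltaDerivAt_integral`). This turns the linear equation into a Volterra equation,
solved forward in time by Picard iteration (`exists_isLinearSolution_of_isLeast`), while uniqueness
forward in time is a Grönwall estimate proved by induction along the time scale
(`eq_zero_of_hasDeltaDerivAt`). Backward in time, regressivity makes the forward solutions
invertible, and inverting them gives the solution on all of `𝕋` (`exists_isLinearSolution`).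
-/

open Set Filter Topology MeasureTheory
open scoped Matrix.Norms.Operator

namespace TimeScale

section

variable {𝕋 : Set ℝ} {E : Type*} [NormedAddCommGroup E] [NormedSpace ℝ E]

/-! ### The forward jump and the delta derivative -/

lemma sigma_eq_sInf {t : ℝ} (h : (𝕋 ∩ Ioi t).Nonempty) : sigma 𝕋 t = sInf (𝕋 ∩ Ioi t) :=
  if_pos h

lemma bddBelow_inter_Ioi (𝕋 : Set ℝ) (t : ℝ) : BddBelow (𝕋 ∩ Ioi t) :=
  ⟨t, fun _ hs => le_of_lt hs.2⟩

lemma le_sigma {t : ℝ} (h : (𝕋 ∩ Ioi t).Nonempty) : t ≤ sigma 𝕋 t := by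
  rw [sigma_eq_sInf h]
  exact le_csInf h fun s hs => le_of_lt hs.2

lemma sigma_le {t s : ℝ} (hs : s ∈ 𝕋) (hts : t < s) : sigma 𝕋 t ≤ s := by
  rw [sigma_eq_sInf ⟨s, hs, hts⟩]
  exact csInf_le (bddBelow_inter_Ioi 𝕋 t) ⟨hs, hts⟩

lemma sigma_mem (hc : IsClosed 𝕋) {t : ℝ} (h : (𝕋 ∩ Ioi t).Nonempty) : sigma 𝕋 t ∈ 𝕋 := by
  rw [sigma_eq_sInf h]
  exact hc.closure_subset_iff.2 inter_subset_left (csInf_mem_closure h (bddBelow_inter_Ioi 𝕋 t))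

lemma RightDense.exists_mem_Ioo {t b : ℝ} (hd : RightDense 𝕋 t) (h : (𝕋 ∩ Ioi t).Nonempty)
    (hb : t < b) : ∃ s ∈ 𝕋, t < s ∧ s < b := by
  have : sInf (𝕋 ∩ Ioi t) < b := by rw [← sigma_eq_sInf h, hd]; exact hb
  obtain ⟨s, hs, hsb⟩ := exists_lt_of_csInf_lt h this
  exact ⟨s, hs.1, hs.2, hsb⟩

lemma rightDense_or_lt {t : ℝ} (h : (𝕋 ∩ Ioi t).Nonempty) : RightDense 𝕋 t ∨ t < sigma 𝕋 t :=
  (le_sigma h).eq_or_lt.imp Eq.symm id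

/-- At a right-dense point, the delta derivative is the ordinary derivative within `𝕋`. -/
lemma hasDeltaDerivAt_iff_of_rightDense {f : ℝ → E} {a : E} {t : ℝ} (hd : RightDense 𝕋 t) :
    HasDeltaDerivAt 𝕋 f a t ↔ HasDerivWithinAt f a 𝕋 t := by
  have hd' : sigma 𝕋 t = t := hd
  rw [hasDerivWithinAt_iff_isLittleO, Asymptotics.isLittleO_iff]
  unfold HasDeltaDerivAt
  rw [hd']
  refine forall_congr' fun ε => ?_
  refine forall_congr' fun hε => ?_
  rw [(Metric.nhdsWithin_basis_ball (x := t) (s := 𝕋)).eventually_iff]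
  refine exists_congr fun δ => and_congr_right fun _ => ?_
  have key : ∀ s, ‖f t - f s - (t - s) • a‖ = ‖f s - f t - (s - t) • a‖ := fun s => by
    rw [← norm_neg, show -(f t - f s - (t - s) • a) = f s - f t - (s - t) • a by module]
  refine ⟨fun h s hs => ?_, fun h s hs hst => ?_⟩
  · have := h s hs.2 (by simpa [Real.dist_eq] using hs.1)
    rwa [Real.norm_eq_abs, abs_sub_comm s t, ← key]
  · have := h (x := s) ⟨by simpa [Real.dist_eq] using hst, hs⟩
    rwa [Real.norm_eq_abs, abs_sub_comm s t, ← key] at this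

/-- At a right-scattered point, delta differentiability is continuity within `𝕋`, and the delta
derivative is the difference quotient over the jump. -/
lemma hasDeltaDerivAt_iff_of_lt {f : ℝ → E} {a : E} {t : ℝ} (ht : t ∈ 𝕋) (hd : t < sigma 𝕋 t) :
    HasDeltaDerivAt 𝕋 f a t ↔
      ContinuousWithinAt f 𝕋 t ∧ f (sigma 𝕋 t) = f t + graininess 𝕋 t • a := by
  have hμ : 0 < sigma 𝕋 t - t := sub_pos.2 hd
  constructor
  · intro h
    have h1 : f (sigma 𝕋 t) - f t - (sigma 𝕋 t - t) • a = 0 := by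
      rw [← norm_le_zero_iff]
      refine le_of_forall_pos_le_add fun ε hε => ?_
      obtain ⟨δ, hδ, H⟩ := h (ε / (sigma 𝕋 t - t)) (by positivity)
      have := H t ht (by simpa using hδ)
      rw [abs_of_pos hμ, div_mul_cancel₀ _ hμ.ne'] at this
      linarith
    refine ⟨?_, by unfold graininess; rw [sub_sub, sub_eq_zero] at h1; exact h1⟩
    rw [Metric.continuousWithinAt_iff]
    intro ε hε
    -- the constant `η` makes both error terms at most a third of `ε`
    obtain ⟨δ, hδ, H⟩ := h (ε / 3 / (sigma 𝕋 t - t + 1)) (by positivity)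
    refine ⟨min (min δ 1) (ε / 3 / (‖a‖ + 1)), by positivity, fun s hs hst => ?_⟩
    rw [Real.dist_eq] at hst
    have e1 := H s hs (hst.trans_le ((min_le_left _ _).trans (min_le_left _ _)))
    have e2 : |s - t| < 1 := hst.trans_le ((min_le_left _ _).trans (min_le_right _ _))
    have e3 : |s - t| < ε / 3 / (‖a‖ + 1) := hst.trans_le (min_le_right _ _)
    have e4 : |sigma 𝕋 t - s| ≤ sigma 𝕋 t - t + 1 := by
      rw [abs_le]; constructor <;> linarith [abs_lt.1 e2]
    have e5 : ε / 3 / (sigma 𝕋 t - t + 1) * |sigma 𝕋 t - s| ≤ ε / 3 := by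
      calc _ ≤ ε / 3 / (sigma 𝕋 t - t + 1) * (sigma 𝕋 t - t + 1) := by gcongr
        _ = ε / 3 := by field_simp
    have e6 : ‖(s - t) • a‖ ≤ ε / 3 := by
      rw [norm_smul, Real.norm_eq_abs]
      calc |s - t| * ‖a‖ ≤ ε / 3 / (‖a‖ + 1) * (‖a‖ + 1) := by gcongr; linarith
        _ = ε / 3 := by field_simp
    have e7 : f s - f t = -(f (sigma 𝕋 t) - f s - (sigma 𝕋 t - s) • a) + (s - t) • a := by
      have : f (sigma 𝕋 t) = f t + (sigma 𝕋 t - t) • a := by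
        rw [sub_sub, sub_eq_zero] at h1; exact h1
      rw [this]; module
    rw [dist_eq_norm, e7]
    refine (norm_add_le _ _).trans_lt ?_
    rw [norm_neg]
    linarith
  · rintro ⟨h1, h2⟩ ε hε
    rw [graininess] at h2
    have h3 : ContinuousWithinAt (fun s => f (sigma 𝕋 t) - f s - (sigma 𝕋 t - s) • a) 𝕋 t := by
      fun_prop
    rw [Metric.continuousWithinAt_iff] at h3
    obtain ⟨δ, hδ, H⟩ := h3 (ε * ((sigma 𝕋 t - t) / 2)) (by positivity)
    refine ⟨min δ ((sigma 𝕋 t - t) / 2), by positivity, fun s hs hst => ?_⟩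
    have e1 := H hs (by rw [Real.dist_eq]; exact hst.trans_le (min_le_left _ _))
    have e2 := abs_lt.1 (hst.trans_le (min_le_right _ _))
    have e3 : (sigma 𝕋 t - t) / 2 ≤ |sigma 𝕋 t - s| := by
      refine le_trans ?_ (le_abs_self _); linarith
    rw [h2, dist_eq_norm] at e1
    rw [show f t + (sigma 𝕋 t - t) • a - f t - (sigma 𝕋 t - t) • a = 0 by abel, sub_zero] at e1
    rw [h2]
    exact e1.le.trans (by gcongr)

lemma HasDeltaDerivAt.continuousWithinAt {f : ℝ → E} {a : E} {t : ℝ} (ht : t ∈ 𝕋)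
    (h : (𝕋 ∩ Ioi t).Nonempty) (hf : HasDeltaDerivAt 𝕋 f a t) : ContinuousWithinAt f 𝕋 t := by
  rcases rightDense_or_lt h with hd | hd
  · exact ((hasDeltaDerivAt_iff_of_rightDense hd).1 hf).continuousWithinAt
  · exact ((hasDeltaDerivAt_iff_of_lt ht hd).1 hf).1

lemma HasDeltaDerivAt.sigma_eq {f : ℝ → E} {a : E} {t : ℝ} (ht : t ∈ 𝕋)
    (h : (𝕋 ∩ Ioi t).Nonempty) (hf : HasDeltaDerivAt 𝕋 f a t) :
    f (sigma 𝕋 t) = f t + graininess 𝕋 t • a := by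
  rcases rightDense_or_lt h with hd | hd
  · have : sigma 𝕋 t = t := hd
    simp [graininess, this]
  · exact ((hasDeltaDerivAt_iff_of_lt ht hd).1 hf).2

lemma hasDeltaDerivAt_of_cases {f : ℝ → E} {a : E} {t : ℝ} (ht : t ∈ 𝕋)
    (h : (𝕋 ∩ Ioi t).Nonempty) (hc : ContinuousWithinAt f 𝕋 t)
    (hs : f (sigma 𝕋 t) = f t + graininess 𝕋 t • a)
    (hd : RightDense 𝕋 t → HasDerivWithinAt f a 𝕋 t) : HasDeltaDerivAt 𝕋 f a t := by
  rcases rightDense_or_lt h with h' | h'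
  · exact (hasDeltaDerivAt_iff_of_rightDense h').2 (hd h')
  · exact (hasDeltaDerivAt_iff_of_lt ht h').2 ⟨hc, hs⟩

lemma HasDeltaDerivAt.clm_comp {F : Type*} [NormedAddCommGroup F] [NormedSpace ℝ F] {f : ℝ → E}
    {a : E} {t : ℝ} (ℓ : E →L[ℝ] F) (hf : HasDeltaDerivAt 𝕋 f a t) :
    HasDeltaDerivAt 𝕋 (fun s => ℓ (f s)) (ℓ a) t := by
  intro ε hε
  obtain ⟨δ, hδ, H⟩ := hf (ε / (‖ℓ‖ + 1)) (by positivity)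
  refine ⟨δ, hδ, fun s hs hst => ?_⟩
  rw [← map_sub, ← map_smul, ← map_sub]
  calc _ ≤ ‖ℓ‖ * ‖f (sigma 𝕋 t) - f s - (sigma 𝕋 t - s) • a‖ := ℓ.le_opNorm _
    _ ≤ (‖ℓ‖ + 1) * (ε / (‖ℓ‖ + 1) * |sigma 𝕋 t - s|) := by
        gcongr
        · linarith
        · exact H s hs hst
    _ = ε * |sigma 𝕋 t - s| := by field_simp

lemma HasDeltaDerivAt.add {f g : ℝ → E} {a b : E} {t : ℝ} (hf : HasDeltaDerivAt 𝕋 f a t)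
    (hg : HasDeltaDerivAt 𝕋 g b t) : HasDeltaDerivAt 𝕋 (fun s => f s + g s) (a + b) t := by
  intro ε hε
  obtain ⟨δ, hδ, H⟩ := hf (ε / 2) (by positivity)
  obtain ⟨δ', hδ', H'⟩ := hg (ε / 2) (by positivity)
  refine ⟨min δ δ', by positivity, fun s hs hst => ?_⟩
  have e1 := H s hs (hst.trans_le (min_le_left _ _))
  have e2 := H' s hs (hst.trans_le (min_le_right _ _))
  have : f (sigma 𝕋 t) + g (sigma 𝕋 t) - (f s + g s) - (sigma 𝕋 t - s) • (a + b)
      = (f (sigma 𝕋 t) - f s - (sigma 𝕋 t - s) • a)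
        + (g (sigma 𝕋 t) - g s - (sigma 𝕋 t - s) • b) := by module
  rw [this]
  refine (norm_add_le _ _).trans ?_
  linarith

lemma HasDeltaDerivAt.sub {f g : ℝ → E} {a b : E} {t : ℝ} (hf : HasDeltaDerivAt 𝕋 f a t)
    (hg : HasDeltaDerivAt 𝕋 g b t) : HasDeltaDerivAt 𝕋 (fun s => f s - g s) (a - b) t := by
  simpa [sub_eq_add_neg] using hf.add (hg.clm_comp (-ContinuousLinearMap.id ℝ E))

lemma hasDeltaDerivAt_const (c : E) (t : ℝ) : HasDeltaDerivAt 𝕋 (fun _ => c) 0 t :=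
  fun ε hε => ⟨1, one_pos, fun s _ _ => by simp; positivity⟩

lemma HasDeltaDerivAt.sum {ι : Type*} (u : Finset ι) {f : ι → ℝ → E} {a : ι → E} {t : ℝ}
    (hf : ∀ i ∈ u, HasDeltaDerivAt 𝕋 (f i) (a i) t) :
    HasDeltaDerivAt 𝕋 (fun s => ∑ i ∈ u, f i s) (∑ i ∈ u, a i) t := by
  classical
  induction u using Finset.induction_on with
  | empty => simpa using hasDeltaDerivAt_const (𝕋 := 𝕋) (0 : E) t
  | insert i u hi ih =>
    simp only [Finset.sum_insert hi]
    exact (hf i (by simp)).add (ih fun j hj => hf j (by simp [hj]))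

/-! ### The part of a time scale above one of its points -/

lemma sigma_inter_Ici {a t : ℝ} (hat : a ≤ t) (h : (𝕋 ∩ Ioi t).Nonempty) :
    sigma (𝕋 ∩ Ici a) t = sigma 𝕋 t := by
  have : 𝕋 ∩ Ici a ∩ Ioi t = 𝕋 ∩ Ioi t := by
    ext s
    simp only [mem_inter_iff, mem_Ici, mem_Ioi]
    exact ⟨fun hs => ⟨hs.1.1, hs.2⟩, fun hs => ⟨⟨hs.1, hat.trans hs.2.le⟩, hs.2⟩⟩
  rw [sigma_eq_sInf h, sigma_eq_sInf (by rwa [this]), this]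

lemma nonempty_inter_Ici (hu : ∀ t, (𝕋 ∩ Ioi t).Nonempty) (a t : ℝ) :
    (𝕋 ∩ Ici a ∩ Ioi t).Nonempty := by
  obtain ⟨s, hs, hs'⟩ := hu (max a t)
  exact ⟨s, ⟨hs, (le_max_left a t).trans (le_of_lt hs')⟩, (le_max_right a t).trans_lt hs'⟩

lemma isLeast_inter_Ici {a : ℝ} (ha : a ∈ 𝕋) : IsLeast (𝕋 ∩ Ici a) a :=
  ⟨⟨ha, self_mem_Ici⟩, fun _ hs => hs.2⟩

lemma HasDeltaDerivAt.inter_Ici {f : ℝ → E} {b : E} {a t : ℝ} (hat : a ≤ t)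
    (h : (𝕋 ∩ Ioi t).Nonempty) (hf : HasDeltaDerivAt 𝕋 f b t) :
    HasDeltaDerivAt (𝕋 ∩ Ici a) f b t := by
  intro ε hε
  obtain ⟨δ, hδ, H⟩ := hf ε hε
  rw [sigma_inter_Ici hat h]
  exact ⟨δ, hδ, fun s hs hst => H s hs.1 hst⟩

/-- Delta differentiability is local: it passes from `𝕋 ∩ [a, ∞)` to `𝕋` at a point near which
all of `𝕋` lies above `a`. -/
lemma HasDeltaDerivAt.of_inter_Ici {f g : ℝ → E} {b : E} {a t : ℝ} (hat : a ≤ t)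
    (h : (𝕋 ∩ Ioi t).Nonempty) (hc : IsClosed 𝕋) (hn : ∀ᶠ s in 𝓝[𝕋] t, a ≤ s)
    (hfg : ∀ s ∈ 𝕋, a ≤ s → g s = f s)
    (hf : HasDeltaDerivAt (𝕋 ∩ Ici a) f b t) : HasDeltaDerivAt 𝕋 g b t := by
  intro ε hε
  obtain ⟨δ, hδ, H⟩ := hf ε hε
  rw [sigma_inter_Ici hat h] at H
  obtain ⟨δ', hδ', H'⟩ := (Metric.nhdsWithin_basis_ball.eventually_iff).1 hn
  refine ⟨min δ δ', by positivity, fun s hs hst => ?_⟩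
  have has : a ≤ s := H' ⟨by
    rw [Metric.mem_ball, Real.dist_eq]; exact hst.trans_le (min_le_right _ _), hs⟩
  rw [hfg _ (sigma_mem hc h) (hat.trans (le_sigma h)), hfg s hs has]
  exact H s ⟨hs, has⟩ (hst.trans_le (min_le_left _ _))

/-! ### Induction on a time scale, and uniqueness for linear equations -/

/-- The induction principle on a time scale with least element `a`. -/
lemma induction_of_isLeast (hc : IsClosed 𝕋) {a : ℝ} (ha : IsLeast 𝕋 a) {P : ℝ → Prop}
    (base : P a) (scattered : ∀ t ∈ 𝕋, t < sigma 𝕋 t → P t → P (sigma 𝕋 t))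
    (dense : ∀ t ∈ 𝕋, RightDense 𝕋 t → P t → ∀ᶠ s in 𝓝[𝕋 ∩ Ioi t] t, P s)
    (left : ∀ t ∈ 𝕋, (𝓝[𝕋 ∩ Iio t] t).NeBot → (∀ s ∈ 𝕋, s < t → P s) → P t) :
    ∀ t ∈ 𝕋, P t := by
  intro b hb
  have hab : a ≤ b := ha.2 hb
  set G : Set ℝ := {t | t ∈ 𝕋 ∧ t ≤ b ∧ ∀ s ∈ 𝕋, s ≤ t → P s} with hG
  have haG : a ∈ G := ⟨ha.1, hab, fun s hs hsa => by rwa [le_antisymm hsa (ha.2 hs)]⟩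
  have hGb : BddAbove G := ⟨b, fun t ht => ht.2.1⟩
  set c := sSup G with hcdef
  have hcc : c ∈ closure G := csSup_mem_closure ⟨a, haG⟩ hGb
  have hc𝕋 : c ∈ 𝕋 := hc.closure_subset_iff.2 (fun t ht => ht.1) hcc
  have hcb : c ≤ b := csSup_le ⟨a, haG⟩ fun t ht => ht.2.1
  have hlt : ∀ s ∈ 𝕋, s < c → P s := fun s hs hsc => by
    obtain ⟨t, ht, hst⟩ := exists_lt_of_lt_csSup ⟨a, haG⟩ hsc
    exact ht.2.2 s hs hst.le
  have hcG : c ∈ G := by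
    by_contra hcn
    refine hcn ⟨hc𝕋, hcb, fun s hs hsc => ?_⟩
    rcases hsc.lt_or_eq with hsc | hsc
    · exact hlt s hs hsc
    · rw [hsc]
      refine left c hc𝕋 ?_ hlt
      refine NeBot.mono (mem_closure_iff_nhdsWithin_neBot.1 hcc) (nhdsWithin_mono _ fun t ht => ?_)
      refine ⟨ht.1, lt_of_le_of_ne (le_csSup hGb ht) ?_⟩
      intro htc
      exact hcn (by rw [hcdef, ← htc]; exact ht)
  rcases hcb.eq_or_lt with hcb | hcb
  · exact hcG.2.2 b hb hcb.ge
  exfalso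
  have hne : (𝕋 ∩ Ioi c).Nonempty := ⟨b, hb, hcb⟩
  have hPc : P c := hcG.2.2 c hc𝕋 le_rfl
  rcases rightDense_or_lt hne with hd | hd
  · obtain ⟨δ, hδ, H⟩ := (Metric.nhdsWithin_basis_ball.eventually_iff).1 (dense c hc𝕋 hd hPc)
    obtain ⟨s, hs, hcs, hsb⟩ := hd.exists_mem_Ioo hne (lt_min hcb (by linarith : c < c + δ))
    have hsG : s ∈ G := by
      refine ⟨hs, (hsb.trans_le (min_le_left _ _)).le, fun r hr hrs => ?_⟩
      rcases le_or_gt r c with hrc | hrc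
      · exact hcG.2.2 r hr hrc
      · refine H ⟨?_, hr, hrc⟩
        have := hsb.trans_le (min_le_right _ _)
        rw [Metric.mem_ball, Real.dist_eq, abs_lt]
        constructor <;> linarith
    exact absurd (le_csSup hGb hsG) (not_le.2 hcs)
  · have hsG : sigma 𝕋 c ∈ G := by
      refine ⟨sigma_mem hc hne, sigma_le hb hcb, fun r hr hrs => ?_⟩
      rcases le_or_gt r c with hrc | hrc
      · exact hcG.2.2 r hr hrc
      · rw [le_antisymm hrs (sigma_le hr hrc)]
        exact scattered c hc𝕋 hd hPc
    exact absurd (le_csSup hGb hsG) (not_le.2 hd)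

/-- A Grönwall argument: a function that vanishes at the least element of `𝕋` and whose delta
derivative is bounded by a constant multiple of the function on `𝕋 ∩ (-∞, b]` vanishes there. -/
lemma eq_zero_of_hasDeltaDerivAt (hc : IsClosed 𝕋) (hu : ∀ t, (𝕋 ∩ Ioi t).Nonempty) {a b K : ℝ}
    (ha : IsLeast 𝕋 a) {w w' : ℝ → E} (hw : ∀ t ∈ 𝕋, HasDeltaDerivAt 𝕋 w (w' t) t)
    (hK0 : 0 ≤ K) (hK : ∀ t ∈ 𝕋, t ≤ b → ‖w' t‖ ≤ K * ‖w t‖) (h0 : w a = 0) :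
    ∀ t ∈ 𝕋, t ≤ b → w t = 0 := by
  -- it suffices to bound `w` by `ε e^{(K+1)(t-a)}` for all `ε > 0`; the extra `1` in the exponent
  -- absorbs the error in the definition of the derivative
  suffices H : ∀ ε > 0, ∀ t ∈ 𝕋, t ≤ b → ‖w t‖ ≤ ε * Real.exp ((K + 1) * (t - a)) by
    intro t ht htb
    rw [← norm_le_zero_iff]
    refine le_of_forall_pos_le_add fun ε hε => ?_
    have := H (ε / Real.exp ((K + 1) * (t - a))) (by positivity) t ht htb
    rw [div_mul_cancel₀ _ (Real.exp_pos _).ne'] at this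
    linarith
  intro ε hε
  have grow : ∀ t s : ℝ, t ≤ s → Real.exp ((K + 1) * (t - a)) * (1 + (K + 1) * (s - t))
      ≤ Real.exp ((K + 1) * (s - a)) := fun t s hts => by
    have : (K + 1) * (s - a) = (K + 1) * (t - a) + (K + 1) * (s - t) := by ring
    rw [this, Real.exp_add]
    gcongr
    linarith [Real.add_one_le_exp ((K + 1) * (s - t))]
  refine induction_of_isLeast hc ha (P := fun t => t ≤ b → _) ?_ ?_ ?_ ?_
  · intro _
    rw [h0, norm_zero]; positivity
  · intro t ht hd IH hsb
    have IH' := IH (hd.le.trans hsb)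
    have h2 := (hw t ht).sigma_eq ht (hu t)
    refine le_trans ?_ (grow t _ hd.le |> mul_le_mul_of_nonneg_left <| hε.le)
    have hμ : 0 ≤ graininess 𝕋 t := sub_nonneg.2 hd.le
    have e1 : ‖w (sigma 𝕋 t)‖ ≤ ‖w t‖ + graininess 𝕋 t * (K * ‖w t‖) := by
      rw [h2]
      refine (norm_add_le _ _).trans ?_
      rw [norm_smul, Real.norm_eq_abs, abs_of_nonneg hμ]
      gcongr
      exact hK t ht (hd.le.trans hsb)
    calc _ ≤ ‖w t‖ * (1 + (K + 1) * graininess 𝕋 t) := by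
          nlinarith [mul_nonneg hμ (norm_nonneg (w t))]
      _ ≤ (ε * Real.exp ((K + 1) * (t - a))) * (1 + (K + 1) * graininess 𝕋 t) := by gcongr
      _ = _ := by rw [graininess]; ring
  · intro t ht hd IH
    have hder := hw t ht
    obtain ⟨δ, hδ, H⟩ := hder ε hε
    have hσ : sigma 𝕋 t = t := hd
    rw [hσ] at H
    have : ∀ᶠ s in 𝓝[𝕋 ∩ Ioi t] t, s ∈ 𝕋 ∩ Ioi t := self_mem_nhdsWithin
    filter_upwards [this, mem_nhdsWithin_of_mem_nhds (Metric.ball_mem_nhds t hδ)] with s hs hsδ hsb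
    have hts : t < s := hs.2
    have IH' := IH (hts.le.trans hsb)
    have e0 := H s hs.1 (by simpa [Real.dist_eq] using hsδ)
    have e1 : ‖w s‖ ≤ ‖w t‖ + (s - t) * (K * ‖w t‖) + ε * (s - t) := by
      have : w s = w t + (s - t) • w' t - (w t - w s - (t - s) • w' t) := by module
      rw [this]
      refine (norm_sub_le _ _).trans ?_
      gcongr
      · refine (norm_add_le _ _).trans ?_
        rw [norm_smul, Real.norm_eq_abs, abs_of_pos (sub_pos.2 hts)]
        gcongr
        exact hK t ht (hts.le.trans hsb)
      · rwa [abs_sub_comm, abs_of_pos (sub_pos.2 hts)] at e0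
    have e2 : 1 ≤ Real.exp ((K + 1) * (t - a)) := by
      rw [Real.one_le_exp_iff]
      have : a ≤ t := ha.2 ht
      exact mul_nonneg (by linarith) (by linarith)
    refine le_trans ?_ (grow t _ hts.le |> mul_le_mul_of_nonneg_left <| hε.le)
    set X := Real.exp ((K + 1) * (t - a))
    have hst : 0 ≤ s - t := by linarith
    calc _ ≤ ‖w t‖ + (s - t) * (K * ‖w t‖) + ε * (s - t) := e1
      _ ≤ ε * X + (s - t) * (K * (ε * X)) + (ε * X) * (s - t) := by
        gcongr
        nlinarith
      _ = _ := by ring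
  · intro t ht hne IH htb
    have hcont : ContinuousWithinAt (fun s => ‖w s‖ - ε * Real.exp ((K + 1) * (s - a))) 𝕋 t := by
      have := (hw t ht).continuousWithinAt ht (hu t)
      fun_prop
    have hle := le_of_tendsto (b := (0 : ℝ)) (hcont.mono_left
      (nhdsWithin_mono t inter_subset_left) : Tendsto _ (𝓝[𝕋 ∩ Iio t] t) _) ?_
    · linarith
    · filter_upwards [self_mem_nhdsWithin] with s hs
      have := IH s hs.1 hs.2 ((le_of_lt hs.2).trans htb)
      linarith

end

section

variable {𝕋 : Set ℝ} {E : Type*} [NormedAddCommGroup E]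

/-! ### Delta integrable functions -/

/-- A function on `𝕋` that is continuous at right-dense points and locally bounded. This is what
integration needs of an rd-continuous function; existence of the left-sided limits only enters
through local boundedness. -/
structure RdRegular (𝕋 : Set ℝ) (f : ℝ → E) : Prop where
  continuousWithinAt : ∀ t ∈ 𝕋, RightDense 𝕋 t → ContinuousWithinAt f 𝕋 t
  bounded : ∀ t ∈ 𝕋, ∃ K : ℝ, ∀ᶠ s in 𝓝[𝕋] t, ‖f s‖ ≤ K

lemma exists_eventually_norm_le {f : ℝ → E} {l : E} {F : Filter ℝ}
    (h : Tendsto f F (𝓝 l)) : ∃ K : ℝ, ∀ᶠ s in F, ‖f s‖ ≤ K :=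
  ⟨‖l‖ + 1, (h.norm.eventually_lt_const (lt_add_one ‖l‖)).mono fun _ hs => hs.le⟩

lemma rdRegular_of_continuousOn {f : ℝ → E} (hf : ContinuousOn f 𝕋) : RdRegular 𝕋 f :=
  ⟨fun t ht _ => hf t ht, fun t ht => exists_eventually_norm_le (hf t ht)⟩

/-- No points of `𝕋` accumulate from the right at a right-scattered point. -/
lemma nhdsWithin_inter_Ioi_eq_bot {t : ℝ} (hd : t < sigma 𝕋 t) : 𝓝[𝕋 ∩ Ioi t] t = ⊥ := by
  rw [nhdsWithin, inf_principal_eq_bot]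
  filter_upwards [Iio_mem_nhds hd] with s hs hs'
  exact absurd (sigma_le hs'.1 hs'.2) (not_le.2 hs)

lemma nhdsWithin_inter_Iio_eq_bot {t : ℝ} (hd : ¬ LeftDense 𝕋 t) :
    𝓝[𝕋 ∩ Iio t] t = ⊥ := by
  by_cases hne : (𝕋 ∩ Iio t).Nonempty
  · have hb : BddAbove (𝕋 ∩ Iio t) := ⟨t, fun s hs => le_of_lt hs.2⟩
    have hbj : backJump 𝕋 t = sSup (𝕋 ∩ Iio t) := if_pos hne
    have hlt : sSup (𝕋 ∩ Iio t) < t := by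
      refine lt_of_le_of_ne (csSup_le hne fun s hs => le_of_lt hs.2) ?_
      rw [← hbj]
      exact hd
    rw [nhdsWithin, inf_principal_eq_bot]
    filter_upwards [Ioi_mem_nhds hlt] with s hs hs'
    exact absurd (le_csSup hb hs') (not_le.2 hs)
  · rw [not_nonempty_iff_eq_empty.1 hne, nhdsWithin_empty]

lemma nhdsWithin_le_sup {t : ℝ} (s : Set ℝ) :
    𝓝[s] t ≤ pure t ⊔ (𝓝[s ∩ Iio t] t ⊔ 𝓝[s ∩ Ioi t] t) := by
  rw [← nhdsWithin_singleton, ← nhdsWithin_union, ← nhdsWithin_union]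
  refine nhdsWithin_mono t fun x hx => ?_
  rcases lt_trichotomy x t with h | h | h
  · exact Or.inr (Or.inl ⟨hx, h⟩)
  · exact Or.inl h
  · exact Or.inr (Or.inr ⟨hx, h⟩)

lemma RdContinuous.rdRegular (hu : ∀ t, (𝕋 ∩ Ioi t).Nonempty) {f : ℝ → ℝ}
    (hf : RdContinuous 𝕋 f) : RdRegular 𝕋 f := by
  refine ⟨hf.1, fun t ht => ?_⟩
  obtain ⟨K₁, h₁⟩ : ∃ K : ℝ, ∀ᶠ s in 𝓝[𝕋 ∩ Iio t] t, ‖f s‖ ≤ K := by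
    by_cases hd : LeftDense 𝕋 t
    · obtain ⟨l, hl⟩ := hf.2 t ht hd
      exact exists_eventually_norm_le hl
    · exact ⟨0, by simp [nhdsWithin_inter_Iio_eq_bot hd]⟩
  obtain ⟨K₂, h₂⟩ : ∃ K : ℝ, ∀ᶠ s in 𝓝[𝕋 ∩ Ioi t] t, ‖f s‖ ≤ K := by
    rcases rightDense_or_lt (hu t) with hd | hd
    · exact exists_eventually_norm_le
        ((hf.1 t ht hd).mono_left (nhdsWithin_mono t inter_subset_left))
    · exact ⟨0, by simp [nhdsWithin_inter_Ioi_eq_bot hd]⟩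
  refine ⟨max ‖f t‖ (max K₁ K₂), Eventually.filter_mono (nhdsWithin_le_sup 𝕋) ?_⟩
  refine eventually_sup.2 ⟨by simp, eventually_sup.2 ⟨?_, ?_⟩⟩
  · exact h₁.mono fun s hs => hs.trans (by simp)
  · exact h₂.mono fun s hs => hs.trans (by simp)

lemma RdRegular.exists_bound (hc : IsClosed 𝕋) {f : ℝ → E} (hf : RdRegular 𝕋 f) (a b : ℝ) :
    ∃ K : ℝ, 0 < K ∧ ∀ t ∈ 𝕋, a ≤ t → t ≤ b → ‖f t‖ ≤ K := by
  have hcomp : IsCompact (𝕋 ∩ Icc a b) := isCompact_Icc.inter_left hc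
  obtain ⟨K, hK⟩ : ∃ K : ℝ, ∀ t ∈ 𝕋 ∩ Icc a b, ‖f t‖ ≤ K := by
    refine hcomp.induction_on (p := fun s => ∃ K : ℝ, ∀ t ∈ s, ‖f t‖ ≤ K) ⟨0, by simp⟩
      (fun s s' hs ⟨K, hK⟩ => ⟨K, fun t ht => hK t (hs ht)⟩) ?_ ?_
    · rintro s s' ⟨K, hK⟩ ⟨K', hK'⟩
      refine ⟨max K K', fun t ht => ?_⟩
      rcases ht with ht | ht
      · exact (hK t ht).trans (le_max_left _ _)
      · exact (hK' t ht).trans (le_max_right _ _)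
    · intro t ht
      obtain ⟨K, hK⟩ := hf.bounded t ht.1
      exact ⟨_, Filter.Eventually.filter_mono (nhdsWithin_mono t inter_subset_left) hK,
        K, fun s hs => hs⟩
  exact ⟨max K 1, by positivity, fun t ht h1 h2 => (hK t ⟨ht, h1, h2⟩).trans (le_max_left _ _)⟩

lemma RdRegular.add {f g : ℝ → E} (hf : RdRegular 𝕋 f) (hg : RdRegular 𝕋 g) :
    RdRegular 𝕋 (fun t => f t + g t) := by
  refine ⟨fun t ht hd => (hf.1 t ht hd).add (hg.1 t ht hd), fun t ht => ?_⟩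
  obtain ⟨K, hK⟩ := hf.2 t ht
  obtain ⟨K', hK'⟩ := hg.2 t ht
  exact ⟨K + K', by filter_upwards [hK, hK'] with s h h' using norm_add_le_of_le h h'⟩

lemma RdRegular.mul {R : Type*} [NormedRing R] {f g : ℝ → R}
    (hf : RdRegular 𝕋 f) (hg : RdRegular 𝕋 g) : RdRegular 𝕋 (fun t => f t * g t) := by
  refine ⟨fun t ht hd => (hf.1 t ht hd).mul (hg.1 t ht hd), fun t ht => ?_⟩
  obtain ⟨K, hK⟩ := hf.2 t ht
  obtain ⟨K', hK'⟩ := hg.2 t ht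
  refine ⟨K * K', ?_⟩
  filter_upwards [hK, hK'] with s h h'
  exact (norm_mul_le _ _).trans (mul_le_mul h h' (norm_nonneg _) ((norm_nonneg _).trans h))

lemma RdRegular.inter_Ici (hu : ∀ t, (𝕋 ∩ Ioi t).Nonempty) {f : ℝ → E} (hf : RdRegular 𝕋 f)
    (a : ℝ) : RdRegular (𝕋 ∩ Ici a) f := by
  refine ⟨fun t ht hd => (hf.1 t ht.1 ?_).mono inter_subset_left, fun t ht => ?_⟩
  · rwa [RightDense, sigma_inter_Ici ht.2 (hu t)] at hd
  · obtain ⟨K, hK⟩ := hf.2 t ht.1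
    exact ⟨K, Filter.Eventually.filter_mono (nhdsWithin_mono t inter_subset_left) hK⟩

lemma RdRegular.clm_comp [NormedSpace ℝ E] {F : Type*} [NormedAddCommGroup F]
    [NormedSpace ℝ F] {f : ℝ → E} (ℓ : E →L[ℝ] F) (hf : RdRegular 𝕋 f) : RdRegular 𝕋 (fun t => ℓ (f t)) := by
  refine ⟨fun t ht hd => ℓ.continuous.continuousAt.comp_continuousWithinAt (hf.1 t ht hd),
    fun t ht => ?_⟩
  obtain ⟨K, hK⟩ := hf.2 t ht
  exact ⟨‖ℓ‖ * K, by filter_upwards [hK] with s h using ℓ.le_opNorm_of_le h⟩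

/-! ### Antiderivatives -/

open Classical in
/-- The retraction of the real line onto `𝕋` that sends a point to the last point of `𝕋` before
it (and to the least point of `𝕋` if there is none). The delta integral of `f` is the ordinary
integral of `f` composed with it. -/
noncomputable def lastPoint (𝕋 : Set ℝ) (s : ℝ) : ℝ :=
  if (𝕋 ∩ Iic s).Nonempty then sSup (𝕋 ∩ Iic s) else sInf 𝕋

lemma bddAbove_inter_Iic (𝕋 : Set ℝ) (s : ℝ) : BddAbove (𝕋 ∩ Iic s) := ⟨s, fun _ h => h.2⟩

lemma lastPoint_mem (h : IsTimeScale 𝕋) (s : ℝ) : lastPoint 𝕋 s ∈ 𝕋 := by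
  unfold lastPoint
  split_ifs with hne
  · exact h.isClosed.closure_subset_iff.2 inter_subset_left
      (csSup_mem_closure hne (bddAbove_inter_Iic 𝕋 s))
  · refine h.isClosed.csInf_mem h.nonempty ⟨s, fun x hx => ?_⟩
    by_contra hxs
    exact hne ⟨x, hx, (not_le.1 hxs).le⟩

lemma le_lastPoint {c s : ℝ} (hc : c ∈ 𝕋) (hcs : c ≤ s) : c ≤ lastPoint 𝕋 s := by
  rw [lastPoint, if_pos ⟨c, hc, hcs⟩]
  exact le_csSup (bddAbove_inter_Iic 𝕋 s) ⟨hc, hcs⟩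

lemma lastPoint_le {c s : ℝ} (hc : c ∈ 𝕋) (hcs : c ≤ s) : lastPoint 𝕋 s ≤ s := by
  rw [lastPoint, if_pos ⟨c, hc, hcs⟩]
  exact csSup_le ⟨c, hc, hcs⟩ fun x hx => hx.2

lemma lastPoint_of_mem {t : ℝ} (ht : t ∈ 𝕋) : lastPoint 𝕋 t = t :=
  le_antisymm (lastPoint_le ht le_rfl) (le_lastPoint ht le_rfl)

lemma lastPoint_congr {s s' : ℝ} (hs : s ≤ s') (h : ∀ x ∈ 𝕋, x ≤ s' → x ≤ s) :
    lastPoint 𝕋 s' = lastPoint 𝕋 s := by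
  have : 𝕋 ∩ Iic s' = 𝕋 ∩ Iic s :=
    ext fun x => ⟨fun hx => ⟨hx.1, h x hx.1 hx.2⟩, fun hx => ⟨hx.1, hx.2.trans hs⟩⟩
  unfold lastPoint
  rw [this]

lemma lastPoint_eq_of_lt_sigma {t s : ℝ} (ht : t ∈ 𝕋) (hts : t ≤ s) (hs : s < sigma 𝕋 t) :
    lastPoint 𝕋 s = t := by
  rw [lastPoint_congr hts fun x hx hxs => ?_, lastPoint_of_mem ht]
  by_contra hxt
  exact absurd (sigma_le hx (not_le.1 hxt)) (not_le.2 (hxs.trans_lt hs))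

lemma monotone_lastPoint (h : IsTimeScale 𝕋) : Monotone (lastPoint 𝕋) := by
  intro s s' hs
  by_cases hne : ∃ c ∈ 𝕋, c ≤ s
  · obtain ⟨c, hc, hcs⟩ := hne
    exact le_lastPoint (lastPoint_mem h s) ((lastPoint_le hc hcs).trans hs)
  · push Not at hne
    rw [lastPoint, if_neg]
    · exact csInf_le ⟨s, fun x hx => (hne x hx).le⟩ (lastPoint_mem h s')
    · rintro ⟨x, hx, hxs⟩
      exact absurd hxs (not_le.2 (hne x hx))

/-- Composition with `lastPoint` turns continuity at right-dense points into continuity from the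
right everywhere. -/
lemma continuousWithinAt_comp_lastPoint (h : IsTimeScale 𝕋) (hu : ∀ t, (𝕋 ∩ Ioi t).Nonempty)
    {f : ℝ → E} (hf : ∀ t ∈ 𝕋, RightDense 𝕋 t → ContinuousWithinAt f 𝕋 t) (s : ℝ) :
    ContinuousWithinAt (fun s => f (lastPoint 𝕋 s)) (Ici s) s := by
  have of_eventually : (∀ᶠ s' in 𝓝 s, s ≤ s' → lastPoint 𝕋 s' = lastPoint 𝕋 s) →
      ContinuousWithinAt (fun s => f (lastPoint 𝕋 s)) (Ici s) s := fun hev => by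
    refine (continuousWithinAt_const (b := f (lastPoint 𝕋 s))).congr_of_eventuallyEq ?_ rfl
    filter_upwards [self_mem_nhdsWithin, nhdsWithin_le_nhds hev] with s' h1 h2
    rw [h2 h1]
  by_cases hs : s ∈ 𝕋
  · rcases rightDense_or_lt (hu s) with hd | hd
    · have h1 : ContinuousWithinAt f 𝕋 (lastPoint 𝕋 s) := by
        rw [lastPoint_of_mem hs]; exact hf s hs hd
      refine ContinuousWithinAt.comp (t := 𝕋) h1 ?_ fun x _ => lastPoint_mem h x
      rw [ContinuousWithinAt, lastPoint_of_mem hs]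
      refine tendsto_of_tendsto_of_tendsto_of_le_of_le' tendsto_const_nhds
        (tendsto_id.mono_left nhdsWithin_le_nhds) ?_ ?_
      · filter_upwards [self_mem_nhdsWithin] with x hx using le_lastPoint hs hx
      · filter_upwards [self_mem_nhdsWithin] with x hx using lastPoint_le hs hx
    · refine of_eventually ?_
      filter_upwards [Iio_mem_nhds hd] with s' hs' hss'
      rw [lastPoint_eq_of_lt_sigma hs hss' hs', lastPoint_of_mem hs]
  · refine of_eventually ?_
    obtain ⟨δ, hδ, H⟩ := Metric.isOpen_iff.1 h.isClosed.isOpen_compl s hs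
    filter_upwards [Metric.ball_mem_nhds s hδ] with s' hs' hss'
    refine lastPoint_congr hss' fun x hx hxs' => ?_
    by_contra hxs
    refine H ?_ hx
    rw [Metric.mem_ball, Real.dist_eq, abs_lt] at hs' ⊢
    constructor <;> linarith [hs'.2, not_le.1 hxs]

/-- A right-continuous function on the line is the limit of its discretizations
`s ↦ g((⌊ns⌋ + 1) / n)`, hence measurable. -/
lemma stronglyMeasurable_of_rightContinuous {g : ℝ → E}
    (hg : ∀ s, ContinuousWithinAt g (Ici s) s) : StronglyMeasurable g := by
  refine stronglyMeasurable_of_tendsto (u := atTop)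
    (f := fun (n : ℕ) s => g ((⌊((n : ℝ) + 1) * s⌋ + 1) / ((n : ℝ) + 1))) (fun n => ?_) ?_
  · have h1 : StronglyMeasurable fun k : ℤ => g (((k : ℝ) + 1) / ((n : ℝ) + 1)) :=
      StronglyMeasurable.of_discrete
    exact h1.comp_measurable (Int.measurable_floor.comp (measurable_const.mul measurable_id))
  · refine tendsto_pi_nhds.2 fun s => ?_
    refine (hg s).tendsto.comp (tendsto_nhdsWithin_iff.2 ⟨?_, ?_⟩)
    · have h0 : Tendsto (fun n : ℕ => s + 1 / ((n : ℝ) + 1)) atTop (𝓝 s) := by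
        simpa using tendsto_const_nhds.add (tendsto_one_div_add_atTop_nhds_zero_nat (𝕜 := ℝ))
      refine tendsto_of_tendsto_of_tendsto_of_le_of_le tendsto_const_nhds h0 ?_ ?_
      · intro n
        have hn : (0 : ℝ) < (n : ℝ) + 1 := by positivity
        simp only
        rw [le_div_iff₀ hn, mul_comm]
        exact (Int.lt_floor_add_one _).le
      · intro n
        have hn : (0 : ℝ) < (n : ℝ) + 1 := by positivity
        simp only
        rw [div_le_iff₀ hn, add_mul s, div_mul_cancel₀ _ hn.ne', mul_comm s]
        linarith [Int.floor_le (((n : ℝ) + 1) * s)]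
    · refine Eventually.of_forall fun n => ?_
      have hn : (0 : ℝ) < (n : ℝ) + 1 := by positivity
      rw [mem_Ici, le_div_iff₀ hn, mul_comm]
      exact (Int.lt_floor_add_one _).le

lemma RdRegular.stronglyMeasurable (h : IsTimeScale 𝕋) (hu : ∀ t, (𝕋 ∩ Ioi t).Nonempty)
    {f : ℝ → E} (hf : RdRegular 𝕋 f) : StronglyMeasurable fun s => f (lastPoint 𝕋 s) :=
  stronglyMeasurable_of_rightContinuous
    (continuousWithinAt_comp_lastPoint h hu hf.continuousWithinAt)

lemma RdRegular.intervalIntegrable (h : IsTimeScale 𝕋) (hu : ∀ t, (𝕋 ∩ Ioi t).Nonempty)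
    {f : ℝ → E} (hf : RdRegular 𝕋 f) (a b : ℝ) :
    IntervalIntegrable (fun s => f (lastPoint 𝕋 s)) volume a b := by
  rw [intervalIntegrable_iff]
  obtain ⟨K, -, hK⟩ := hf.exists_bound h.isClosed (lastPoint 𝕋 (min a b)) (lastPoint 𝕋 (max a b))
  refine Measure.integrableOn_of_bounded (M := K) (by simp [uIoc])
    (hf.stronglyMeasurable h hu).aestronglyMeasurable ?_
  filter_upwards [ae_restrict_mem measurableSet_uIoc] with s hs
  exact hK _ (lastPoint_mem h s) (monotone_lastPoint h hs.1.le) (monotone_lastPoint h hs.2)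

variable [NormedSpace ℝ E] [CompleteSpace E]

theorem RdRegular.hasDeltaDerivAt_integral (h : IsTimeScale 𝕋) (hu : ∀ t, (𝕋 ∩ Ioi t).Nonempty)
    {f : ℝ → E} (hf : RdRegular 𝕋 f) (c : ℝ) {t : ℝ} (ht : t ∈ 𝕋) :
    HasDeltaDerivAt 𝕋 (fun x => ∫ s in c..x, f (lastPoint 𝕋 s)) (f t) t := by
  have hint := hf.intervalIntegrable h hu
  rcases rightDense_or_lt (hu t) with hd | hd
  · intro ε hε
    obtain ⟨δ, hδ, H⟩ := (Metric.continuousWithinAt_iff.1 (hf.1 t ht hd)) ε hε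
    have hσ : sigma 𝕋 t = t := hd
    refine ⟨δ, hδ, fun s hs hst => ?_⟩
    rw [hσ, intervalIntegral.integral_interval_sub_left (hint _ _) (hint _ _),
      ← intervalIntegral.integral_const, ← intervalIntegral.integral_sub (hint _ _)
      intervalIntegrable_const]
    refine intervalIntegral.norm_integral_le_of_norm_le_const fun x hx => ?_
    rw [← dist_eq_norm]
    refine (H (lastPoint_mem h x) ?_).le
    have h1 : min s t ≤ lastPoint 𝕋 x :=
      le_lastPoint (by rcases min_choice s t with h | h <;> rw [h] <;> assumption) hx.1.le
    have h2 : lastPoint 𝕋 x ≤ max s t :=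
      (lastPoint_le (c := min s t)
        (by rcases min_choice s t with h | h <;> rw [h] <;> assumption) hx.1.le).trans hx.2
    rw [Real.dist_eq]
    rw [abs_lt] at hst ⊢
    rcases le_total s t with hst' | hst' <;> simp [hst'] at h1 h2 <;> constructor <;> linarith
  · refine (hasDeltaDerivAt_iff_of_lt ht hd).2
      ⟨(intervalIntegral.continuous_primitive hint c).continuousWithinAt, ?_⟩
    rw [← sub_eq_iff_eq_add', intervalIntegral.integral_interval_sub_left (hint _ _) (hint _ _),
      graininess, ← intervalIntegral.integral_const]
    refine intervalIntegral.integral_congr_Ioo_of_le hd.le fun s hs => ?_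
    rw [lastPoint_eq_of_lt_sigma ht hs.1.le hs.2]

end

section

variable {𝕋 : Set ℝ} {R : Type*} [NormedRing R] [NormedAlgebra ℝ R]

/-! ### Linear equations in a Banach algebra -/

/-- `Y` solves the linear dynamic equation `Y^Δ = A(t) Y` on `𝕋`. The values may be taken in any
normed algebra, so that matrix equations, and scalar equations for determinants, are treated
together. -/
def IsLinearSolution (𝕋 : Set ℝ) (A Y : ℝ → R) : Prop :=
  ∀ t ∈ 𝕋, HasDeltaDerivAt 𝕋 Y (A t * Y t) t

variable {A : ℝ → R}

lemma isTimeScale_inter_Ici (h : IsTimeScale 𝕋) {a : ℝ} (ha : a ∈ 𝕋) : IsTimeScale (𝕋 ∩ Ici a) :=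
  ⟨⟨a, ha, self_mem_Ici⟩, h.isClosed.inter isClosed_Ici⟩

lemma IsLinearSolution.inter_Ici (hu : ∀ t, (𝕋 ∩ Ioi t).Nonempty) {Y : ℝ → R}
    (hY : IsLinearSolution 𝕋 A Y) (a : ℝ) : IsLinearSolution (𝕋 ∩ Ici a) A Y :=
  fun t ht => (hY t ht.1).inter_Ici ht.2 (hu t)

lemma IsLinearSolution.mul_const {Y : ℝ → R} (hY : IsLinearSolution 𝕋 A Y) (c : R) :
    IsLinearSolution 𝕋 A (fun t => Y t * c) := fun t ht => by
  have := (hY t ht).clm_comp ((ContinuousLinearMap.mul ℝ R).flip c)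
  simpa [mul_assoc] using this

lemma IsLinearSolution.continuousOn (hu : ∀ t, (𝕋 ∩ Ioi t).Nonempty) {Y : ℝ → R}
    (hY : IsLinearSolution 𝕋 A Y) : ContinuousOn Y 𝕋 :=
  fun t ht => (hY t ht).continuousWithinAt ht (hu t)

/-- Solutions are determined by their values at the least element. -/
lemma IsLinearSolution.eq_of_isLeast (hc : IsClosed 𝕋) (hu : ∀ t, (𝕋 ∩ Ioi t).Nonempty)
    (hA : RdRegular 𝕋 A) {a : ℝ} (ha : IsLeast 𝕋 a) {V W : ℝ → R} (hV : IsLinearSolution 𝕋 A V)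
    (hW : IsLinearSolution 𝕋 A W) (h0 : V a = W a) {t : ℝ} (ht : t ∈ 𝕋) : V t = W t := by
  obtain ⟨K, hK0, hK⟩ := hA.exists_bound hc a t
  rw [← sub_eq_zero]
  refine eq_zero_of_hasDeltaDerivAt hc hu ha (w := fun t => V t - W t)
    (fun s hs => (hV s hs).sub (hW s hs)) hK0.le (fun s hs hst => ?_) (sub_eq_zero.2 h0) t ht le_rfl
  rw [← mul_sub]
  exact (norm_mul_le _ _).trans (by gcongr; exact hK s hs (ha.2 hs) hst)

lemma IsLinearSolution.eq_of_eq (h : IsTimeScale 𝕋) (hu : ∀ t, (𝕋 ∩ Ioi t).Nonempty)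
    (hA : RdRegular 𝕋 A) {V W : ℝ → R} (hV : IsLinearSolution 𝕋 A V)
    (hW : IsLinearSolution 𝕋 A W) {s t : ℝ} (hs : s ∈ 𝕋) (ht : t ∈ 𝕋) (hst : s ≤ t)
    (h0 : V s = W s) : V t = W t :=
  (hV.inter_Ici hu s).eq_of_isLeast (isTimeScale_inter_Ici h hs).isClosed
    (nonempty_inter_Ici hu s) (hA.inter_Ici hu s) (isLeast_inter_Ici hs) (hW.inter_Ici hu s) h0
    ⟨ht, hst⟩

/-- The Picard iterates for `Y^Δ = A(t) Y`, `Y(a) = 1`. -/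
noncomputable def picard (𝕋 : Set ℝ) (A : ℝ → R) (a : ℝ) : ℕ → ℝ → R
  | 0, _ => 1
  | n + 1, t => 1 + ∫ s in a..t, A (lastPoint 𝕋 s) * picard 𝕋 A a n (lastPoint 𝕋 s)

/-- The weight `e^{2K(t-a)}` makes the integral operator of the equation a contraction by the
factor `1/2`. -/
lemma norm_integral_mul_le (h : IsTimeScale 𝕋) {a b K C : ℝ} (ha : a ∈ 𝕋) (hK0 : 0 < K)
    (hC : 0 ≤ C) (hK : ∀ t ∈ 𝕋, a ≤ t → t ≤ b → ‖A t‖ ≤ K) {u : ℝ → R}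
    (hu : ∀ t ∈ 𝕋, a ≤ t → t ≤ b → ‖u t‖ ≤ C * Real.exp (2 * K * (t - a))) {t : ℝ} (hat : a ≤ t)
    (htb : t ≤ b) :
    ‖∫ s in a..t, A (lastPoint 𝕋 s) * u (lastPoint 𝕋 s)‖
      ≤ C / 2 * (Real.exp (2 * K * (t - a)) - 1) := by
  have hder : ∀ s : ℝ, HasDerivAt (fun s => C / 2 * Real.exp (2 * K * (s - a)))
      (K * (C * Real.exp (2 * K * (s - a)))) s := fun s => by
    have h1 : HasDerivAt (fun s => 2 * K * (s - a)) (2 * K) s := by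
      simpa using ((hasDerivAt_id s).sub_const a).const_mul (2 * K)
    exact (h1.exp.const_mul (C / 2)).congr_deriv (by ring)
  have hcont : Continuous fun s => K * (C * Real.exp (2 * K * (s - a))) := by fun_prop
  have hint := intervalIntegral.integral_eq_sub_of_hasDerivAt (fun s _ => hder s)
    (hcont.intervalIntegrable a t)
  have : C / 2 * (Real.exp (2 * K * (t - a)) - 1)
      = ∫ s in a..t, K * (C * Real.exp (2 * K * (s - a))) := by
    rw [hint]; simp; ring
  rw [this]
  refine intervalIntegral.norm_integral_le_of_norm_le hat ?_ (hcont.intervalIntegrable a t)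
  refine Eventually.of_forall fun s hs => (norm_mul_le _ _).trans ?_
  have h1 : a ≤ lastPoint 𝕋 s := le_lastPoint ha hs.1.le
  have h2 : lastPoint 𝕋 s ≤ s := lastPoint_le ha hs.1.le
  have h3 : lastPoint 𝕋 s ≤ b := h2.trans (hs.2.trans htb)
  have h4 := lastPoint_mem h s
  refine mul_le_mul (hK _ h4 h1 h3) ((hu _ h4 h1 h3).trans ?_) (norm_nonneg _) hK0.le
  gcongr

lemma norm_picard_le (h : IsTimeScale 𝕋) {a b K : ℝ} (ha : a ∈ 𝕋) (hK0 : 0 < K)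
    (hK : ∀ t ∈ 𝕋, a ≤ t → t ≤ b → ‖A t‖ ≤ K) (n : ℕ) :
    ∀ t ∈ 𝕋, a ≤ t → t ≤ b →
      ‖picard 𝕋 A a n t‖ ≤ 2 * ‖(1 : R)‖ * Real.exp (2 * K * (t - a)) := by
  have hexp : ∀ t, a ≤ t → 1 ≤ Real.exp (2 * K * (t - a)) := fun t hat =>
    Real.one_le_exp (mul_nonneg (by positivity) (by linarith))
  induction n with
  | zero =>
    intro t _ hat _
    have := hexp t hat
    simp only [picard]
    nlinarith [norm_nonneg (1 : R)]
  | succ n ih =>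
    intro t ht hat htb
    simp only [picard]
    refine (norm_add_le _ _).trans ?_
    have := norm_integral_mul_le h ha hK0 (by positivity) hK ih hat htb
    nlinarith [norm_nonneg (1 : R), hexp t hat]

lemma continuous_picard (h : IsTimeScale 𝕋) (hu : ∀ t, (𝕋 ∩ Ioi t).Nonempty)
    (hA : RdRegular 𝕋 A) (a : ℝ) (n : ℕ) : Continuous (picard 𝕋 A a n) := by
  induction n with
  | zero => exact continuous_const
  | succ n ih =>
    exact continuous_const.add (intervalIntegral.continuous_primitive
      ((hA.mul (rdRegular_of_continuousOn ih.continuousOn)).intervalIntegrable h hu) a)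

lemma norm_picard_sub_le (h : IsTimeScale 𝕋) (hu : ∀ t, (𝕋 ∩ Ioi t).Nonempty)
    (hA : RdRegular 𝕋 A) {a b K : ℝ} (ha : a ∈ 𝕋) (hK0 : 0 < K)
    (hK : ∀ t ∈ 𝕋, a ≤ t → t ≤ b → ‖A t‖ ≤ K) (n : ℕ) :
    ∀ t ∈ 𝕋, a ≤ t → t ≤ b → ‖picard 𝕋 A a (n + 1) t - picard 𝕋 A a n t‖
      ≤ 2 * ‖(1 : R)‖ / 2 ^ n * Real.exp (2 * K * (t - a)) := by
  induction n with
  | zero =>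
    intro t ht hat htb
    have h1 := norm_integral_mul_le h ha hK0 (by positivity) hK
      (norm_picard_le h ha hK0 hK 0) hat htb
    simp only [picard, add_sub_cancel_left, pow_zero, div_one] at h1 ⊢
    nlinarith [norm_nonneg (1 : R), Real.exp_pos (2 * K * (t - a))]
  | succ n ih =>
    intro t ht hat htb
    have hint : ∀ m, IntervalIntegrable
        (fun s => A (lastPoint 𝕋 s) * picard 𝕋 A a m (lastPoint 𝕋 s)) volume a t := fun m =>
      (hA.mul (rdRegular_of_continuousOn (continuous_picard h hu hA a m).continuousOn)
        ).intervalIntegrable h hu a t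
    have h1 := norm_integral_mul_le h ha hK0 (by positivity) hK ih hat htb
    rw [picard, picard, add_sub_add_left_eq_sub, ← intervalIntegral.integral_sub (hint _) (hint _)]
    simp only [← mul_sub]
    refine h1.trans ?_
    rw [pow_succ, div_mul_eq_div_div]
    gcongr
    linarith

variable [CompleteSpace R]

/-- Existence for linear equations on a time scale with a least element, by Picard iteration. -/
theorem exists_isLinearSolution_of_isLeast (h : IsTimeScale 𝕋) (hu : ∀ t, (𝕋 ∩ Ioi t).Nonempty)
    (hA : RdRegular 𝕋 A) {a : ℝ} (ha : IsLeast 𝕋 a) :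
    ∃ Y : ℝ → R, Y a = 1 ∧ IsLinearSolution 𝕋 A Y := by
  have hconv : ∀ t ∈ 𝕋, ∃ l, Tendsto (fun n => picard 𝕋 A a n t) atTop (𝓝 l) := by
    intro t ht
    obtain ⟨K, hK0, hK⟩ := hA.exists_bound h.isClosed a t
    refine cauchySeq_tendsto_of_complete (cauchySeq_of_le_geometric_two
      (C := 4 * ‖(1 : R)‖ * Real.exp (2 * K * (t - a))) fun n => ?_)
    rw [dist_comm, dist_eq_norm]
    refine (norm_picard_sub_le h hu hA ha.1 hK0 hK n t ht (ha.2 ht) le_rfl).trans (le_of_eq ?_)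
    ring
  choose! P hP using hconv
  have hPn : ∀ n, RdRegular 𝕋 fun t => A t * picard 𝕋 A a n t := fun n =>
    hA.mul (rdRegular_of_continuousOn (continuous_picard h hu hA a n).continuousOn)
  have hlim : ∀ s, Tendsto (fun n => A (lastPoint 𝕋 s) * picard 𝕋 A a n (lastPoint 𝕋 s)) atTop
      (𝓝 (A (lastPoint 𝕋 s) * P (lastPoint 𝕋 s))) := fun s =>
    (hP _ (lastPoint_mem h s)).const_mul _
  have hbound : ∀ c d : ℝ, ∃ C : ℝ, ∀ n, ∀ s ∈ uIoc c d,
      ‖A (lastPoint 𝕋 s) * picard 𝕋 A a n (lastPoint 𝕋 s)‖ ≤ C := by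
    intro c d
    obtain ⟨K, hK0, hK⟩ := hA.exists_bound h.isClosed a (lastPoint 𝕋 (max c d))
    refine ⟨K * (2 * ‖(1 : R)‖ * Real.exp (2 * K * (lastPoint 𝕋 (max c d) - a))),
      fun n s hs => ?_⟩
    have h1 := lastPoint_mem h s
    have h2 : lastPoint 𝕋 s ≤ lastPoint 𝕋 (max c d) := monotone_lastPoint h hs.2
    refine (norm_mul_le _ _).trans (mul_le_mul (hK _ h1 (ha.2 h1) h2)
      ((norm_picard_le h ha.1 hK0 hK n _ h1 (ha.2 h1) h2).trans ?_) (norm_nonneg _) hK0.le)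
    gcongr
  have hmeas : StronglyMeasurable fun s => A (lastPoint 𝕋 s) * P (lastPoint 𝕋 s) :=
    stronglyMeasurable_of_tendsto atTop (fun n => (hPn n).stronglyMeasurable h hu)
      (tendsto_pi_nhds.2 hlim)
  have hint : ∀ c d, IntervalIntegrable (fun s => A (lastPoint 𝕋 s) * P (lastPoint 𝕋 s))
      volume c d := by
    intro c d
    obtain ⟨C, hC⟩ := hbound c d
    rw [intervalIntegrable_iff]
    refine Measure.integrableOn_of_bounded (M := C) (by simp [uIoc]) hmeas.aestronglyMeasurable ?_
    filter_upwards [ae_restrict_mem measurableSet_uIoc] with s hs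
    exact le_of_tendsto (hlim s).norm (Eventually.of_forall fun n => hC n s hs)
  have heq : ∀ t ∈ 𝕋, P t = 1 + ∫ s in a..t, A (lastPoint 𝕋 s) * P (lastPoint 𝕋 s) := by
    intro t ht
    obtain ⟨C, hC⟩ := hbound a t
    refine tendsto_nhds_unique ((tendsto_add_atTop_iff_nat 1).2 (hP t ht)) ?_
    simp only [picard]
    refine tendsto_const_nhds.add ?_
    refine intervalIntegral.tendsto_integral_filter_of_dominated_convergence (fun _ => C) ?_ ?_
      intervalIntegrable_const ?_
    · exact Eventually.of_forall fun n => ((hPn n).stronglyMeasurable h hu).aestronglyMeasurable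
    · exact Eventually.of_forall fun n => Eventually.of_forall fun s hs => hC n s hs
    · exact Eventually.of_forall fun s _ => hlim s
  have hcont : ContinuousOn P 𝕋 :=
    (continuous_const.add (intervalIntegral.continuous_primitive hint a)).continuousOn.congr heq
  have hreg : RdRegular 𝕋 fun t => A t * P t := hA.mul (rdRegular_of_continuousOn hcont)
  refine ⟨fun t => 1 + ∫ s in a..t, A (lastPoint 𝕋 s) * P (lastPoint 𝕋 s), by simp,
    fun t ht => ?_⟩
  beta_reduce
  rw [← heq t ht]
  simpa using (hasDeltaDerivAt_const (1 : R) t).add (hreg.hasDeltaDerivAt_integral h hu a ht)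

/-- Existence on the whole time scale, provided that solutions starting from `1` stay invertible:
below the initial point `t₀`, the solution is `t ↦ X_t(t₀)⁻¹`, where `X_t` is the solution that
starts from `1` at `t`. -/
theorem exists_isLinearSolution (h : IsTimeScale 𝕋) (hu : ∀ t, (𝕋 ∩ Ioi t).Nonempty)
    (hA : RdRegular 𝕋 A)
    (hunit : ∀ a ∈ 𝕋, ∀ X : ℝ → R, X a = 1 → IsLinearSolution (𝕋 ∩ Ici a) A X →
      ∀ t ∈ 𝕋, a ≤ t → IsUnit (X t)) {t₀ : ℝ} (ht₀ : t₀ ∈ 𝕋) :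
    ∃ Y : ℝ → R, Y t₀ = 1 ∧ IsLinearSolution 𝕋 A Y := by
  have hex : ∀ a ∈ 𝕋, ∃ X : ℝ → R, X a = 1 ∧ IsLinearSolution (𝕋 ∩ Ici a) A X := fun a ha =>
    exists_isLinearSolution_of_isLeast (isTimeScale_inter_Ici h ha) (nonempty_inter_Ici hu a)
      (hA.inter_Ici hu a) (isLeast_inter_Ici ha)
  choose! X hX1 hX using hex
  have hXu : ∀ a ∈ 𝕋, ∀ t ∈ 𝕋, a ≤ t → IsUnit (X a t) := fun a ha =>
    hunit a ha (X a) (hX1 a ha) (hX a ha)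
  have cocycle : ∀ a ∈ 𝕋, ∀ c ∈ 𝕋, ∀ t ∈ 𝕋, a ≤ c → c ≤ t → X a t = X c t * X a c := by
    intro a ha c hc t ht hac hct
    have h1 : IsLinearSolution (𝕋 ∩ Ici c) A (X a) := by
      have := (hX a ha).inter_Ici (nonempty_inter_Ici hu a) c
      rwa [inter_assoc, inter_eq_right.2 (Ici_subset_Ici.2 hac)] at this
    refine h1.eq_of_isLeast (isTimeScale_inter_Ici h hc).isClosed (nonempty_inter_Ici hu c)
      (hA.inter_Ici hu c) (isLeast_inter_Ici hc) ((hX c hc).mul_const (X a c)) ?_ ⟨ht, hct⟩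
    rw [hX1 c hc, one_mul]
  set Y : ℝ → R := fun t => if t₀ ≤ t then X t₀ t else Ring.inverse (X t t₀) with hY
  have hYb : ∀ b ∈ 𝕋, b ≤ t₀ → ∀ t ∈ 𝕋, b ≤ t → Y t = X b t * Ring.inverse (X b t₀) := by
    intro b hb hbt₀ t ht hbt
    have hub := hXu b hb t₀ ht₀ hbt₀
    by_cases htt : t₀ ≤ t
    · rw [hY]
      simp only [htt, if_true]
      rw [cocycle b hb t₀ ht₀ t ht hbt₀ htt, mul_assoc, Ring.mul_inverse_cancel _ hub, mul_one]
    · rw [hY]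
      simp only [htt, if_false]
      have hle := (not_le.1 htt).le
      have hut := hXu t ht t₀ ht₀ hle
      rw [← hut.mul_right_inj, Ring.mul_inverse_cancel _ hut, ← mul_assoc,
        ← cocycle b hb t ht t₀ ht₀ hbt hle, Ring.mul_inverse_cancel _ hub]
  refine ⟨Y, by simp [hY, hX1 t₀ ht₀], fun t ht => ?_⟩
  have hmin : min t t₀ ∈ 𝕋 := by rcases min_choice t t₀ with h | h <;> rw [h] <;> assumption
  obtain ⟨b, hb, hbm, hn⟩ : ∃ b ∈ 𝕋, b ≤ min t t₀ ∧ ∀ᶠ s in 𝓝[𝕋] t, b ≤ s := by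
    by_cases hlow : ∃ b ∈ 𝕋, b < min t t₀
    · obtain ⟨b, hb, hbm⟩ := hlow
      refine ⟨b, hb, hbm.le, nhdsWithin_le_nhds ?_⟩
      filter_upwards [Ioi_mem_nhds (hbm.trans_le (min_le_left _ _))] with s hs using le_of_lt hs
    · push Not at hlow
      exact ⟨_, hmin, le_rfl, by filter_upwards [self_mem_nhdsWithin] with s hs using hlow s hs⟩
  have hbt := hbm.trans (min_le_left _ _)
  have hbt₀ := hbm.trans (min_le_right _ _)
  rw [hYb b hb hbt₀ t ht hbt]
  exact HasDeltaDerivAt.of_inter_Ici hbt (hu t) h.isClosed hn (hYb b hb hbt₀)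
    ((hX b hb).mul_const _ t ⟨ht, hbt⟩)

end

section

variable {𝕋 : Set ℝ}

/-! ### The exponential function of a time scale -/

lemma graininess_nonneg (hu : ∀ t, (𝕋 ∩ Ioi t).Nonempty) (t : ℝ) : 0 ≤ graininess 𝕋 t :=
  sub_nonneg.2 (le_sigma (hu t))

lemma RightDense.graininess_eq_zero {t : ℝ} (hd : RightDense 𝕋 t) : graininess 𝕋 t = 0 :=
  sub_eq_zero.2 hd

lemma graininess_inter_Ici (hu : ∀ t, (𝕋 ∩ Ioi t).Nonempty) {a t : ℝ} (hat : a ≤ t) :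
    graininess (𝕋 ∩ Ici a) t = graininess 𝕋 t := by
  rw [graininess, sigma_inter_Ici hat (hu t), graininess]

lemma tendsto_graininess_left (hu : ∀ t, (𝕋 ∩ Ioi t).Nonempty) {t : ℝ} (ht : t ∈ 𝕋) :
    Tendsto (graininess 𝕋) (𝓝[𝕋 ∩ Iio t] t) (𝓝 0) := by
  have h1 : Tendsto (fun s => t - s) (𝓝[𝕋 ∩ Iio t] t) (𝓝 0) := by
    have : Tendsto (fun s => t - s) (𝓝 t) (𝓝 (t - t)) := tendsto_const_nhds.sub tendsto_id
    rw [sub_self] at this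
    exact this.mono_left nhdsWithin_le_nhds
  refine tendsto_of_tendsto_of_tendsto_of_le_of_le' tendsto_const_nhds h1
    (Eventually.of_forall (graininess_nonneg hu)) ?_
  filter_upwards [self_mem_nhdsWithin] with s hs
  exact sub_le_sub_right (sigma_le ht hs.2) s

lemma tendsto_graininess_right (hu : ∀ t, (𝕋 ∩ Ioi t).Nonempty) (t : ℝ) :
    Tendsto (graininess 𝕋) (𝓝[𝕋 ∩ Ioi t] t) (𝓝 0) := by
  rcases rightDense_or_lt (hu t) with hd | hd
  · refine tendsto_order.2 ⟨fun b hb => Eventually.of_forall fun s =>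
      hb.trans_le (graininess_nonneg hu s), fun b hb => ?_⟩
    obtain ⟨x, hx, htx, hxb⟩ := hd.exists_mem_Ioo (hu t) (lt_add_of_pos_right t hb)
    filter_upwards [self_mem_nhdsWithin,
      mem_nhdsWithin_of_mem_nhds (Iio_mem_nhds htx)] with s hs hsx
    have h1 : sigma 𝕋 s ≤ x := sigma_le hx hsx
    have h2 : t < s := hs.2
    rw [graininess]
    linarith
  · rw [nhdsWithin_inter_Ioi_eq_bot hd]
    exact tendsto_bot

/-- The graininess tends to `0` at each point, the point itself excluded. -/
lemma tendsto_graininess (hu : ∀ t, (𝕋 ∩ Ioi t).Nonempty) {t : ℝ} (ht : t ∈ 𝕋) :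
    Tendsto (graininess 𝕋) (𝓝[𝕋 ∩ Iio t] t ⊔ 𝓝[𝕋 ∩ Ioi t] t) (𝓝 0) :=
  (tendsto_graininess_left hu ht).sup (tendsto_graininess_right hu t)

lemma continuousWithinAt_graininess (hu : ∀ t, (𝕋 ∩ Ioi t).Nonempty) {t : ℝ} (ht : t ∈ 𝕋)
    (hd : RightDense 𝕋 t) : ContinuousWithinAt (graininess 𝕋) 𝕋 t := by
  refine Tendsto.mono_left ?_ (nhdsWithin_le_sup 𝕋)
  rw [hd.graininess_eq_zero]
  exact Tendsto.sup (by rw [← hd.graininess_eq_zero]; exact tendsto_pure_nhds _ _)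
    (tendsto_graininess hu ht)

/-- Local boundedness may be checked on punctured neighbourhoods. -/
lemma exists_bound_of_punctured {E : Type*} [NormedAddCommGroup E] {f : ℝ → E} {t K : ℝ}
    (h : ∀ᶠ s in 𝓝[𝕋 ∩ Iio t] t ⊔ 𝓝[𝕋 ∩ Ioi t] t, ‖f s‖ ≤ K) :
    ∃ K : ℝ, ∀ᶠ s in 𝓝[𝕋] t, ‖f s‖ ≤ K := by
  refine ⟨max ‖f t‖ K, Eventually.filter_mono (nhdsWithin_le_sup 𝕋) (eventually_sup.2 ⟨?_, ?_⟩)⟩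
  · simp
  · exact h.mono fun s hs => hs.trans (le_max_right _ _)

lemma rdRegular_graininess (hu : ∀ t, (𝕋 ∩ Ioi t).Nonempty) : RdRegular 𝕋 (graininess 𝕋) := by
  refine ⟨fun t ht => continuousWithinAt_graininess hu ht, fun t ht => ?_⟩
  obtain ⟨K, hK⟩ := exists_eventually_norm_le (tendsto_graininess hu ht)
  exact exists_bound_of_punctured hK

lemma cylinder_zero (z : ℂ) : cylinder 0 z = z := if_pos rfl

lemma norm_cylinder_sub_le {h : ℝ} (hh : 0 ≤ h) {z : ℂ} (hz : h * ‖z‖ ≤ 1 / 2) :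
    ‖cylinder h z - z‖ ≤ h * ‖z‖ ^ 2 := by
  rcases hh.eq_or_lt with rfl | hh
  · simp [cylinder_zero]
  have hn : ‖z * (h : ℂ)‖ = h * ‖z‖ := by
    rw [norm_mul, Complex.norm_real, Real.norm_eq_abs, abs_of_pos hh, mul_comm]
  have hc : (h : ℂ) ≠ 0 := by exact_mod_cast hh.ne'
  have h1 := Complex.norm_log_one_add_sub_self_le (z := z * h) (by rw [hn]; linarith)
  rw [hn] at h1
  have h2 : (1 - h * ‖z‖)⁻¹ ≤ 2 := by
    rw [inv_le_comm₀ (by linarith) (by norm_num)]; linarith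
  have h3 : cylinder h z - z = (Complex.log (1 + z * h) - z * h) / h := by
    rw [cylinder, if_neg hh.ne']; field_simp
  rw [h3, norm_div, Complex.norm_real, Real.norm_eq_abs, abs_of_pos hh, div_le_iff₀ hh]
  calc _ ≤ (h * ‖z‖) ^ 2 * (1 - h * ‖z‖)⁻¹ / 2 := h1
    _ ≤ (h * ‖z‖) ^ 2 * 2 / 2 := by gcongr
    _ = _ := by ring

lemma rdRegular_cylinder (hu : ∀ t, (𝕋 ∩ Ioi t).Nonempty) {r : ℝ → ℝ} (hr : RdRegular 𝕋 r) :
    RdRegular 𝕋 (fun t => cylinder (graininess 𝕋 t) (r t : ℂ)) := by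
  -- on each filter along which `μ → 0` and `r` is bounded, the two functions are close
  have close : ∀ (F : Filter ℝ) (K : ℝ), Tendsto (graininess 𝕋) F (𝓝 0) → (∀ᶠ s in F, ‖r s‖ ≤ K) →
      ∀ᶠ s in F, ‖cylinder (graininess 𝕋 s) (r s : ℂ) - (r s : ℂ)‖ ≤ graininess 𝕋 s * K ^ 2 ∧
        ‖r s‖ ≤ K := by
    intro F K hF hK
    have h0 : Tendsto (fun s => graininess 𝕋 s * K) F (𝓝 0) := by simpa using hF.mul_const K
    filter_upwards [hK, h0.eventually_lt_const (by norm_num : (0 : ℝ) < 1 / 2)] with s h1 h2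
    have hμ := graininess_nonneg hu s
    have h3 : ‖(r s : ℂ)‖ ≤ K := by rwa [Complex.norm_real]
    refine ⟨(norm_cylinder_sub_le hμ ?_).trans (by gcongr), h1⟩
    exact (mul_le_mul_of_nonneg_left h3 hμ).trans h2.le
  constructor
  · intro t ht hd
    obtain ⟨K, hK⟩ := hr.bounded t ht
    have hμ : Tendsto (graininess 𝕋) (𝓝[𝕋] t) (𝓝 0) := by
      have := continuousWithinAt_graininess hu ht hd
      rwa [ContinuousWithinAt, hd.graininess_eq_zero] at this
    have h1 : Tendsto (fun s => cylinder (graininess 𝕋 s) (r s : ℂ) - (r s : ℂ)) (𝓝[𝕋] t)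
        (𝓝 0) := by
      refine squeeze_zero_norm' ((close _ K hμ hK).mono fun s hs => hs.1) ?_
      simpa using hμ.mul_const (K ^ 2)
    have h2 : Tendsto (fun s => (r s : ℂ)) (𝓝[𝕋] t) (𝓝 (r t : ℂ)) :=
      (Complex.continuous_ofReal.tendsto _).comp (hr.continuousWithinAt t ht hd)
    have h3 := h1.add h2
    simp only [sub_add_cancel, zero_add] at h3
    rw [ContinuousWithinAt, hd.graininess_eq_zero, cylinder_zero]
    exact h3
  · intro t ht
    obtain ⟨K, hK⟩ := hr.bounded t ht
    have hμ := tendsto_graininess hu ht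
    have hle : 𝓝[𝕋 ∩ Iio t] t ⊔ 𝓝[𝕋 ∩ Ioi t] t ≤ 𝓝[𝕋] t :=
      sup_le (nhdsWithin_mono t inter_subset_left) (nhdsWithin_mono t inter_subset_left)
    refine exists_bound_of_punctured (K := K ^ 2 + K) ?_
    filter_upwards [close _ K hμ (hK.filter_mono hle),
      hμ.eventually_lt_const (zero_lt_one' ℝ)] with s hs hs1
    have h1 : ‖(r s : ℂ)‖ ≤ K := by rw [Complex.norm_real]; exact hs.2
    calc _ = ‖(cylinder (graininess 𝕋 s) (r s : ℂ) - (r s : ℂ)) + (r s : ℂ)‖ := by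
          rw [sub_add_cancel]
      _ ≤ graininess 𝕋 s * K ^ 2 + K := norm_add_le_of_le hs.1 h1
      _ ≤ 1 * K ^ 2 + K := by gcongr
      _ = _ := by ring

lemma expFun_self (r : ℝ → ℝ) (s : ℝ) : expFun 𝕋 r s s = 1 := by
  unfold expFun deltaIntegral
  split_ifs <;> simp

lemma exp_mul_cylinder {h : ℝ} {z : ℂ} (hz : 1 + h * z ≠ 0) :
    Complex.exp (h * cylinder h z) = 1 + h * z := by
  unfold cylinder
  split_ifs with h0
  · simp [h0]
  · have hc : (h : ℂ) ≠ 0 := by exact_mod_cast h0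
    rw [mul_div_cancel₀ _ hc, mul_comm z, Complex.exp_log hz]

/-- The exponential function `e_r(·, s)` solves `u^Δ = r u`. -/
theorem isLinearSolution_expFun (h : IsTimeScale 𝕋) (hu : ∀ t, (𝕋 ∩ Ioi t).Nonempty) {r : ℝ → ℝ}
    (hr : RdRegular 𝕋 r) (hreg : ∀ t ∈ 𝕋, 1 + graininess 𝕋 t * r t ≠ 0) (s : ℝ) :
    IsLinearSolution 𝕋 (fun t => (r t : ℂ)) (fun t => expFun 𝕋 r t s) := by
  have hex : ∃ F : ℝ → ℂ, IsAntideriv 𝕋 F fun t => cylinder (graininess 𝕋 t) (r t : ℂ) :=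
    ⟨_, fun t ht => (rdRegular_cylinder hu hr).hasDeltaDerivAt_integral h hu 0 ht⟩
  obtain ⟨F, hF, heq⟩ : ∃ F : ℝ → ℂ,
      (IsAntideriv 𝕋 F fun t => cylinder (graininess 𝕋 t) (r t : ℂ)) ∧
        ∀ t, expFun 𝕋 r t s = Complex.exp (F t - F s) :=
    ⟨hex.choose, hex.choose_spec, fun t => by rw [expFun, deltaIntegral, dif_pos hex]⟩
  simp only [IsLinearSolution, heq]
  intro t ht
  have hFt := hF t ht
  refine hasDeltaDerivAt_of_cases ht (hu t) ?_ ?_ ?_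
  · have := hFt.continuousWithinAt ht (hu t)
    fun_prop
  · have hne : (1 : ℂ) + graininess 𝕋 t * (r t : ℂ) ≠ 0 := by exact_mod_cast hreg t ht
    rw [hFt.sigma_eq ht (hu t), Complex.real_smul, add_sub_right_comm, Complex.exp_add,
      exp_mul_cylinder hne, Complex.real_smul]
    ring
  · intro hd
    have h1 := (hasDeltaDerivAt_iff_of_rightDense hd).1 hFt
    beta_reduce at h1
    rw [hd.graininess_eq_zero, cylinder_zero] at h1
    exact ((h1.sub_const (F s)).cexp).congr_deriv (mul_comm _ _)

/-! ### Matrix equations and Liouville's formula -/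

/-- A matrix entry as a continuous linear functional. -/
noncomputable def entryCLM {n : ℕ} (i j : Fin n) : Matrix (Fin n) (Fin n) ℝ →L[ℝ] ℝ :=
  LinearMap.toContinuousLinearMap (Matrix.entryLinearMap ℝ ℝ i j)

lemma hasDeltaDerivAt_matrix_iff {n : ℕ} {Y : ℝ → Matrix (Fin n) (Fin n) ℝ}
    {B : Matrix (Fin n) (Fin n) ℝ} {t : ℝ} :
    HasDeltaDerivAt 𝕋 Y B t ↔ ∀ i j, HasDeltaDerivAt 𝕋 (fun s => Y s i j) (B i j) t := by
  refine ⟨fun h i j => h.clm_comp (entryCLM i j), fun h => ?_⟩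
  let ℓ : Fin n → Fin n → ℝ →L[ℝ] Matrix (Fin n) (Fin n) ℝ := fun i j =>
    LinearMap.toContinuousLinearMap (Matrix.singleLinearMap ℝ i j)
  have hsum : ∀ M : Matrix (Fin n) (Fin n) ℝ, M = ∑ i, ∑ j, ℓ i j (M i j) :=
    Matrix.matrix_eq_sum_single
  rw [hsum B, funext fun s => hsum (Y s)]
  exact HasDeltaDerivAt.sum Finset.univ fun i _ => HasDeltaDerivAt.sum Finset.univ fun j _ =>
    (h i j).clm_comp (ℓ i j)

lemma isPrincipalMatrix_iff {n : ℕ} {A Y : ℝ → Matrix (Fin n) (Fin n) ℝ} {t₀ : ℝ} :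
    IsPrincipalMatrix 𝕋 A t₀ Y ↔ Y t₀ = 1 ∧ IsLinearSolution 𝕋 A Y :=
  and_congr_right fun _ => forall_congr' fun _ => forall_congr' fun _ =>
    hasDeltaDerivAt_matrix_iff.symm

lemma rdRegular_coeffMatrix {p q : ℝ → ℝ} (hp : RdRegular 𝕋 p) (hq : RdRegular 𝕋 q) :
    RdRegular 𝕋 (coeffMatrix p q) := by
  have h1 := ((rdRegular_of_continuousOn (𝕋 := 𝕋)
    (continuousOn_const (c := (!![0, 1; 0, 0] : Matrix (Fin 2) (Fin 2) ℝ)))).add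
    (hq.clm_comp (ContinuousLinearMap.toSpanSingleton ℝ
      (!![0, 0; -1, 0] : Matrix (Fin 2) (Fin 2) ℝ)))).add
    (hp.clm_comp (ContinuousLinearMap.toSpanSingleton ℝ
      (!![0, 0; 0, -1] : Matrix (Fin 2) (Fin 2) ℝ)))
  convert h1 using 2 with t
  simp [coeffMatrix]

/-- The determinant of a solution solves `u^Δ = (-p + μ q) u`. -/
lemma IsLinearSolution.det (hu : ∀ t, (𝕋 ∩ Ioi t).Nonempty) {p q : ℝ → ℝ}
    {X : ℝ → Matrix (Fin 2) (Fin 2) ℝ} (hX : IsLinearSolution 𝕋 (coeffMatrix p q) X) :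
    IsLinearSolution 𝕋 (fun t => -p t + graininess 𝕋 t * q t) (fun t => (X t).det) := by
  intro t ht
  have hent := hasDeltaDerivAt_matrix_iff.1 (hX t ht)
  simp only [Matrix.det_fin_two]
  have hc := fun i j => (hent i j).continuousWithinAt ht (hu t)
  refine hasDeltaDerivAt_of_cases ht (hu t) ?_ ?_ ?_
  · exact ((hc 0 0).mul (hc 1 1)).sub ((hc 0 1).mul (hc 1 0))
  · have hs := fun i j => (hent i j).sigma_eq ht (hu t)
    rw [hs 0 0, hs 0 1, hs 1 0, hs 1 1]
    simp [coeffMatrix, Matrix.mul_apply, Fin.sum_univ_two]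
    ring
  · intro hd
    have hder := fun i j => (hasDeltaDerivAt_iff_of_rightDense hd).1 (hent i j)
    refine (((hder 0 0).mul (hder 1 1)).sub ((hder 0 1).mul (hder 1 0))).congr_deriv ?_
    rw [hd.graininess_eq_zero]
    simp [coeffMatrix, Matrix.mul_apply, Fin.sum_univ_two]
    ring

/-- **Liouville's formula**, for a solution defined on the part of `𝕋` above `a`. -/
theorem ofReal_det_eq (h : IsTimeScale 𝕋) (hu : ∀ t, (𝕋 ∩ Ioi t).Nonempty) {p q : ℝ → ℝ}
    (hp : RdRegular 𝕋 p) (hq : RdRegular 𝕋 q)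
    (hreg : ∀ t ∈ 𝕋, 1 - graininess 𝕋 t * p t + graininess 𝕋 t ^ 2 * q t ≠ 0) {a t : ℝ}
    (ha : a ∈ 𝕋) (ht : t ∈ 𝕋) (hat : a ≤ t) {X : ℝ → Matrix (Fin 2) (Fin 2) ℝ}
    (hX : IsLinearSolution (𝕋 ∩ Ici a) (coeffMatrix p q) X) :
    ((X t).det : ℂ) = expFun 𝕋 (fun t => -p t + graininess 𝕋 t * q t) t a * ((X a).det : ℂ) := by
  set r : ℝ → ℝ := fun t => -p t + graininess 𝕋 t * q t with hrdef
  have hr : RdRegular 𝕋 r := by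
    simpa using (hp.clm_comp (-ContinuousLinearMap.id ℝ ℝ)).add ((rdRegular_graininess hu).mul hq)
  have hrc : RdRegular 𝕋 fun t => (r t : ℂ) := hr.clm_comp Complex.ofRealCLM
  have he := isLinearSolution_expFun h hu hr (fun t ht => by
    rw [hrdef]; convert hreg t ht using 1; ring) a
  have hdet : IsLinearSolution (𝕋 ∩ Ici a) (fun t => (r t : ℂ)) (fun t => ((X t).det : ℂ)) := by
    intro t ht
    have h1 := (hX.det (nonempty_inter_Ici hu a) t ht).clm_comp Complex.ofRealCLM
    beta_reduce at h1
    rw [graininess_inter_Ici hu ht.2] at h1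
    simpa [hrdef] using h1
  refine hdet.eq_of_isLeast (isTimeScale_inter_Ici h ha).isClosed (nonempty_inter_Ici hu a)
    (hrc.inter_Ici hu a) (isLeast_inter_Ici ha)
    ((he.inter_Ici hu a).mul_const ((X a).det : ℂ)) ?_ ⟨ht, hat⟩
  rw [expFun_self, one_mul]

lemma expFun_ne_zero (r : ℝ → ℝ) (t s : ℝ) : expFun 𝕋 r t s ≠ 0 := Complex.exp_ne_zero _

theorem exists_principalMatrix (h : IsTimeScale 𝕋) (hu : ∀ t, (𝕋 ∩ Ioi t).Nonempty) {p q : ℝ → ℝ}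
    (hp : RdRegular 𝕋 p) (hq : RdRegular 𝕋 q)
    (hreg : ∀ t ∈ 𝕋, 1 - graininess 𝕋 t * p t + graininess 𝕋 t ^ 2 * q t ≠ 0) {t₀ : ℝ}
    (ht₀ : t₀ ∈ 𝕋) : ∃ Y, IsPrincipalMatrix 𝕋 (coeffMatrix p q) t₀ Y := by
  simp only [isPrincipalMatrix_iff]
  have : CompleteSpace (Matrix (Fin 2) (Fin 2) ℝ) := FiniteDimensional.complete ℝ _
  refine exists_isLinearSolution h hu (rdRegular_coeffMatrix hp hq) ?_ ht₀
  intro a ha X hXa hX t ht hat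
  rw [Matrix.isUnit_iff_isUnit_det, isUnit_iff_ne_zero]
  have h1 := ofReal_det_eq h hu hp hq hreg ha ht hat hX
  rw [hXa, Matrix.det_one, Complex.ofReal_one, mul_one] at h1
  intro h0
  rw [h0, Complex.ofReal_zero] at h1
  exact expFun_ne_zero _ _ _ h1.symm

end

section

variable {𝕋 : Set ℝ} {T : ℝ}

/-! ### Periodic time scales -/

lemma IsPeriodic.add_nat_mul_mem (hT : IsPeriodic 𝕋 T) {t : ℝ} (ht : t ∈ 𝕋) (n : ℕ) :
    t + n * T ∈ 𝕋 := by
  induction n with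
  | zero => simpa using ht
  | succ n ih =>
    have := hT.add_mem _ ih
    rwa [show t + n * T + T = t + ((n + 1 : ℕ) : ℝ) * T by push_cast; ring] at this

lemma IsPeriodic.nonempty_inter_Ioi (hT : IsPeriodic 𝕋 T) (h : IsTimeScale 𝕋) (t : ℝ) :
    (𝕋 ∩ Ioi t).Nonempty := by
  obtain ⟨x, hx⟩ := h.nonempty
  obtain ⟨n, hn⟩ := exists_nat_gt ((t - x) / T)
  rw [div_lt_iff₀ hT.pos] at hn
  exact ⟨_, hT.add_nat_mul_mem hx n, by rw [mem_Ioi]; linarith⟩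

lemma IsPeriodic.sigma_add (hT : IsPeriodic 𝕋 T) {t : ℝ} (ht : t ∈ 𝕋) :
    sigma 𝕋 (t + T) = sigma 𝕋 t + T := by
  have := hT.graininess_add t ht
  unfold graininess at this
  linarith

/-- Translation by `-T` preserves the time scale, except at its lower end: a point of `𝕋` missed
by it would lie strictly inside the translate of a gap of `𝕋`, which is a gap as well. -/
lemma IsPeriodic.sub_mem (hT : IsPeriodic 𝕋 T) (h : IsTimeScale 𝕋) {a t : ℝ} (ha : a ∈ 𝕋)
    (ht : t ∈ 𝕋) (hat : a + T ≤ t) : t - T ∈ 𝕋 := by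
  have hu := hT.nonempty_inter_Ioi h
  have haT : a ≤ t - T := by linarith
  set c := lastPoint 𝕋 (t - T) with hcdef
  have hc : c ∈ 𝕋 := lastPoint_mem h _
  rcases (lastPoint_le ha haT : c ≤ t - T).eq_or_lt with heq | hlt
  · rwa [← heq]
  exfalso
  have hσ : t - T < sigma 𝕋 c := by
    rcases rightDense_or_lt (hu c) with hd | hd
    · obtain ⟨s, hs, hcs, hst⟩ := hd.exists_mem_Ioo (hu c) hlt
      exact absurd (le_lastPoint hs hst.le) (not_le.2 hcs)
    · by_contra hcon
      exact absurd (le_lastPoint (sigma_mem h.isClosed (hu c)) (not_lt.1 hcon)) (not_le.2 hd)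
  have h1 : sigma 𝕋 (c + T) ≤ t := sigma_le ht (by linarith)
  rw [hT.sigma_add hc] at h1
  linarith

lemma IsPeriodic.exists_eq_add (hT : IsPeriodic 𝕋 T) (h : IsTimeScale 𝕋) {a t : ℝ} (ha : a ∈ 𝕋)
    (ht : t ∈ 𝕋) (hat : a ≤ t) :
    ∃ s ∈ 𝕋, a ≤ s ∧ s ≤ a + T ∧ ∃ n : ℕ, t = s + n * T := by
  have hpos := hT.pos
  obtain ⟨n, hn⟩ := exists_nat_gt ((t - a) / T)
  rw [div_lt_iff₀ hpos] at hn
  induction n generalizing t with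
  | zero =>
    rw [Nat.cast_zero, zero_mul] at hn
    linarith
  | succ n ih =>
    rcases le_total t (a + T) with hle | hle
    · exact ⟨t, ht, hat, hle, 0, by simp⟩
    · obtain ⟨s, hs, has, hsT, m, hm⟩ := ih (hT.sub_mem h ha ht hle) (by linarith)
        (by push_cast at hn; linarith)
      exact ⟨s, hs, has, hsT, m + 1, by push_cast; linarith⟩

lemma IsLinearSolution.comp_add {R : Type*} [NormedRing R] [NormedAlgebra ℝ R] {A Y : ℝ → R}
    (hT : IsPeriodic 𝕋 T) (hA : ∀ t ∈ 𝕋, A (t + T) = A t) (hY : IsLinearSolution 𝕋 A Y) :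
    IsLinearSolution 𝕋 A (fun t => Y (t + T)) := by
  intro t ht ε hε
  obtain ⟨δ, hδ, H⟩ := hY (t + T) (hT.add_mem t ht) ε hε
  refine ⟨δ, hδ, fun s hs hst => ?_⟩
  have := H (s + T) (hT.add_mem s hs) (by simpa using hst)
  rwa [hT.sigma_add ht, hA t ht, add_sub_add_right_eq_sub] at this

/-! ### The recurrence `u (n + 2) = A u (n + 1) - u n` -/

/-- For `|A| < 2`, the quadratic form `x² - A x y + y²` is positive definite and invariant. -/
lemma exists_bound_of_recurrence {A : ℝ} (hA : |A| < 2) {u : ℕ → ℝ}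
    (hrec : ∀ n, u (n + 2) = A * u (n + 1) - u n) : ∃ C : ℝ, ∀ n, |u n| ≤ C := by
  have hA' : 0 < 1 - A ^ 2 / 4 := by
    have := sq_lt_sq' (by linarith [abs_lt.1 hA]) (abs_lt.1 hA).2
    linarith
  set Q := u 1 ^ 2 - A * u 1 * u 0 + u 0 ^ 2
  have hQ : ∀ n, u (n + 1) ^ 2 - A * u (n + 1) * u n + u n ^ 2 = Q := by
    intro n
    induction n with
    | zero => rfl
    | succ n ih => rw [hrec n, ← ih]; ring
  refine ⟨√(Q / (1 - A ^ 2 / 4)), fun n => Real.abs_le_sqrt ?_⟩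
  rw [le_div_iff₀ hA', ← hQ n]
  nlinarith [sq_nonneg (u (n + 1) - A / 2 * u n)]

lemma not_bounded_of_recurrence {A : ℝ} (hA : 2 < |A|) {u : ℕ → ℝ} (h0 : u 0 = 2) (h1 : u 1 = A)
    (hrec : ∀ n, u (n + 2) = A * u (n + 1) - u n) : ¬ ∃ C : ℝ, ∀ n, |u n| ≤ C := by
  rintro ⟨C, hC⟩
  have hgrow : ∀ n, |u n| ≤ |u (n + 1)| ∧ (|A| - 1) ^ n ≤ |u (n + 1)| := by
    intro n
    induction n with
    | zero =>
      rw [zero_add, h0, h1, pow_zero, abs_two]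
      exact ⟨hA.le, by linarith⟩
    | succ n ih =>
      have h2 : |A| * |u (n + 1)| ≤ |u (n + 2)| + |u n| := by
        rw [← abs_mul, show A * u (n + 1) = u (n + 2) + u n by rw [hrec]; ring]
        exact abs_add_le _ _
      refine ⟨by nlinarith [ih.1, abs_nonneg (u (n + 1))], ?_⟩
      calc (|A| - 1) ^ (n + 1) = (|A| - 1) ^ n * (|A| - 1) := pow_succ _ _
        _ ≤ |u (n + 1)| * (|A| - 1) := mul_le_mul_of_nonneg_right ih.2 (by linarith)
        _ ≤ |u (n + 2)| := by linarith [ih.1]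
  obtain ⟨n, hn⟩ := pow_unbounded_of_one_lt C (by linarith : 1 < |A| - 1)
  exact absurd ((hgrow n).2.trans (hC _)) (not_le.2 hn)

/-! ### Real matrices of determinant one -/

section Matrix

variable {M : Matrix (Fin 2) (Fin 2) ℝ}

/-- The Cayley–Hamilton relation, as a recurrence for the powers. -/
lemma pow_add_two_of_det_eq_one (hM : M.det = 1) (n : ℕ) :
    M ^ (n + 2) = M.trace • M ^ (n + 1) - M ^ n := by
  have h2 : M * M = M.trace • M - 1 := by
    rw [Matrix.det_fin_two] at hM
    ext i j
    fin_cases i <;> fin_cases j <;>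
      simp [Matrix.mul_apply, Fin.sum_univ_two, Matrix.trace_fin_two] <;> linarith
  rw [pow_add, pow_two, h2, mul_sub, mul_one, mul_smul_comm, ← pow_succ]

lemma exists_bound_pow (hM : M.det = 1) (htr : |M.trace| < 2) :
    ∃ C : ℝ, ∀ n i j, |(M ^ n) i j| ≤ C := by
  have h : ∀ i j, ∃ C : ℝ, ∀ n, |(M ^ n) i j| ≤ C := fun i j =>
    exists_bound_of_recurrence htr fun n => by
      rw [pow_add_two_of_det_eq_one hM]; simp
  choose C hC using h
  refine ⟨∑ i, ∑ j, |C i j|, fun n i j => (hC i j n).trans ((le_abs_self _).trans ?_)⟩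
  refine (Finset.single_le_sum (f := fun j => |C i j|) (fun j _ => abs_nonneg _)
    (Finset.mem_univ j)).trans ?_
  exact Finset.single_le_sum (f := fun i => ∑ j, |C i j|)
    (fun i _ => Finset.sum_nonneg fun j _ => abs_nonneg _) (Finset.mem_univ i)

lemma not_bounded_pow (hM : M.det = 1) (htr : 2 < |M.trace|) :
    ¬ ∃ C : ℝ, ∀ n i j, |(M ^ n) i j| ≤ C := by
  rintro ⟨C, hC⟩
  refine not_bounded_of_recurrence htr (u := fun n => (M ^ n).trace) (by simp) (by simp)
    (fun n => by rw [pow_add_two_of_det_eq_one hM]; simp) ⟨C + C, fun n => ?_⟩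
  rw [Matrix.trace_fin_two]
  exact (abs_add_le _ _).trans (add_le_add (hC n 0 0) (hC n 1 1))

/-- The eigenvalues are the roots `A/2 ± i √(1 - A²/4)` of `z² - A z + 1`. -/
lemma spectrum_of_det_eq_one (hM : M.det = 1) (htr : |M.trace| < 2) :
    ∃ ρ₁ ρ₂ : ℂ, spectrum ℂ (M.map (fun r : ℝ => (r : ℂ))) = {ρ₁, ρ₂} ∧ ρ₁ ≠ ρ₂ ∧
      ‖ρ₁‖ = 1 ∧ ‖ρ₂‖ = 1 := by
  set A := M.trace with hA
  have hA' : 0 < 1 - A ^ 2 / 4 := by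
    have := sq_lt_sq' (by linarith [abs_lt.1 htr]) (abs_lt.1 htr).2
    linarith
  set s := √(1 - A ^ 2 / 4) with hs
  have hspos : 0 < s := Real.sqrt_pos.2 hA'
  have hs2 : s ^ 2 = 1 - A ^ 2 / 4 := Real.sq_sqrt hA'.le
  have hs2' : (s : ℂ) ^ 2 = 1 - (A : ℂ) ^ 2 / 4 := by exact_mod_cast hs2
  have norm_one : ∀ z : ℂ, z.re = A / 2 → z.im ^ 2 = s ^ 2 → ‖z‖ = 1 := fun z h1 h2 => by
    rw [← sq_eq_sq₀ (norm_nonneg z) zero_le_one, ← Complex.normSq_eq_norm_sq, Complex.normSq_apply,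
      ← pow_two, ← pow_two, h1, h2, hs2]
    ring
  refine ⟨⟨A / 2, s⟩, ⟨A / 2, -s⟩, ?_, ?_, norm_one _ rfl rfl, norm_one _ rfl (by simp)⟩
  · ext z
    have hfac : (algebraMap ℂ (Matrix (Fin 2) (Fin 2) ℂ) z - M.map (fun r : ℝ => (r : ℂ))).det
        = (z - ⟨A / 2, s⟩) * (z - ⟨A / 2, -s⟩) := by
      have e1 : (⟨A / 2, s⟩ : ℂ) = A / 2 + s * Complex.I := by apply Complex.ext <;> simp
      have e2 : (⟨A / 2, -s⟩ : ℂ) = A / 2 - s * Complex.I := by apply Complex.ext <;> simp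
      have hd : (M 0 0 : ℂ) * M 1 1 - M 0 1 * M 1 0 = 1 := by
        rw [Matrix.det_fin_two] at hM
        exact_mod_cast hM
      have ht : (A : ℂ) = M 0 0 + M 1 1 := by
        rw [hA, Matrix.trace_fin_two]; push_cast; rfl
      have lhs : (algebraMap ℂ (Matrix (Fin 2) (Fin 2) ℂ) z - M.map (fun r : ℝ => (r : ℂ))).det
          = z ^ 2 - A * z + 1 := by
        rw [ht, ← hd, Matrix.det_fin_two]
        simp [Matrix.algebraMap_matrix_apply]
        ring
      rw [lhs, e1, e2]
      linear_combination ((s : ℂ) ^ 2) * Complex.I_sq - hs2'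
    rw [spectrum.mem_iff, Matrix.isUnit_iff_isUnit_det, isUnit_iff_ne_zero, not_not, hfac,
      mul_eq_zero, sub_eq_zero, sub_eq_zero]
    rfl
  · intro h
    have := congrArg Complex.im h
    simp only at this
    linarith

end Matrix

end

section

variable {𝕋 : Set ℝ} {T : ℝ} {p q : ℝ → ℝ}

/-! ### Floquet theory -/

lemma IsLinearSolution.isSolution {Y : ℝ → Matrix (Fin 2) (Fin 2) ℝ}
    (hY : IsLinearSolution 𝕋 (coeffMatrix p q) Y) (j : Fin 2) (c : ℝ) :
    IsSolution 𝕋 p q (fun t => c * Y t 0 j) (fun t => c * Y t 1 j) := by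
  intro t ht
  have h := fun i => (hasDeltaDerivAt_matrix_iff.1 (hY t ht) i j).clm_comp
    (ContinuousLinearMap.mul ℝ ℝ c)
  simp only [ContinuousLinearMap.mul_apply'] at h
  refine ⟨?_, _, h 1, ?_⟩
  · simpa [coeffMatrix, Matrix.mul_apply, Fin.sum_univ_two] using h 0
  · simp [coeffMatrix, Matrix.mul_apply, Fin.sum_univ_two]
    ring

lemma IsSolution.isLinearSolution {x y : ℝ → ℝ} (hxy : IsSolution 𝕋 p q x y) :
    IsLinearSolution 𝕋 (coeffMatrix p q) (fun t => !![x t, 0; y t, 0]) := by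
  intro t ht
  obtain ⟨hx, z, hz, hzeq⟩ := hxy t ht
  have hz' : z = -(q t * x t) + -(p t * y t) := by linarith
  rw [hz'] at hz
  refine hasDeltaDerivAt_matrix_iff.2 fun i j => ?_
  fin_cases i <;> fin_cases j <;> simp [coeffMatrix, Matrix.mul_apply, Fin.sum_univ_two]
  · exact hx
  · exact hasDeltaDerivAt_const 0 t
  · exact hz
  · exact hasDeltaDerivAt_const 0 t

lemma IsLinearSolution.isUnit (h : IsTimeScale 𝕋) (hu : ∀ t, (𝕋 ∩ Ioi t).Nonempty)
    (hp : RdRegular 𝕋 p) (hq : RdRegular 𝕋 q)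
    (hreg : ∀ t ∈ 𝕋, 1 - graininess 𝕋 t * p t + graininess 𝕋 t ^ 2 * q t ≠ 0) {t₀ : ℝ}
    (ht₀ : t₀ ∈ 𝕋) {Y : ℝ → Matrix (Fin 2) (Fin 2) ℝ}
    (hY : IsLinearSolution 𝕋 (coeffMatrix p q) Y) (hY1 : Y t₀ = 1) {t : ℝ} (ht : t ∈ 𝕋) :
    IsUnit (Y t).det := by
  rw [isUnit_iff_ne_zero]
  intro h0
  rcases le_total t₀ t with hle | hle
  · have := ofReal_det_eq h hu hp hq hreg ht₀ ht hle (hY.inter_Ici hu t₀)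
    rw [hY1, h0, Matrix.det_one, Complex.ofReal_zero, Complex.ofReal_one, mul_one] at this
    exact expFun_ne_zero _ _ _ this.symm
  · have := ofReal_det_eq h hu hp hq hreg ht ht₀ hle (hY.inter_Ici hu t)
    rw [hY1, h0, Matrix.det_one, Complex.ofReal_zero, mul_zero, Complex.ofReal_one] at this
    exact one_ne_zero this

lemma IsLinearSolution.eq_mul_inv_mul (h : IsTimeScale 𝕋) (hu : ∀ t, (𝕋 ∩ Ioi t).Nonempty)
    {A Y V : ℝ → Matrix (Fin 2) (Fin 2) ℝ} (hA : RdRegular 𝕋 A) (hY : IsLinearSolution 𝕋 A Y)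
    (hV : IsLinearSolution 𝕋 A V) {s t : ℝ} (hs : s ∈ 𝕋) (ht : t ∈ 𝕋) (hst : s ≤ t)
    (hYs : IsUnit (Y s).det) : V t = Y t * ((Y s)⁻¹ * V s) :=
  hV.eq_of_eq h hu hA (hY.mul_const _) hs ht hst (Matrix.mul_nonsing_inv_cancel_left _ _ hYs).symm

/-- Floquet's relation `Y(t + T) = Y(t) M` with the monodromy matrix `M = Y(t₀ + T)`. It also holds
below `t₀`, where it comes from uniqueness on `[t, t₀]`. -/
lemma IsLinearSolution.floquet (h : IsTimeScale 𝕋) (hT : IsPeriodic 𝕋 T)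
    {A Y : ℝ → Matrix (Fin 2) (Fin 2) ℝ} (hA : RdRegular 𝕋 A) (hAT : ∀ t ∈ 𝕋, A (t + T) = A t)
    (hY : IsLinearSolution 𝕋 A Y) (hYu : ∀ t ∈ 𝕋, IsUnit (Y t).det) {t₀ : ℝ} (ht₀ : t₀ ∈ 𝕋)
    (hY1 : Y t₀ = 1) {t : ℝ} (ht : t ∈ 𝕋) : Y (t + T) = Y t * Y (t₀ + T) := by
  have hu := hT.nonempty_inter_Ioi h
  rcases le_total t₀ t with hle | hle
  · simpa [hY1] using hY.eq_mul_inv_mul h hu hA (hY.comp_add hT hAT) ht₀ ht hle (hYu t₀ ht₀)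
  · have := hY.eq_mul_inv_mul h hu hA (hY.comp_add hT hAT) ht ht₀ hle (hYu t ht)
    rw [hY1, one_mul] at this
    rw [this, Matrix.mul_nonsing_inv_cancel_left _ _ (hYu t ht)]

lemma IsLinearSolution.floquet_nat (h : IsTimeScale 𝕋) (hT : IsPeriodic 𝕋 T)
    {A Y : ℝ → Matrix (Fin 2) (Fin 2) ℝ} (hA : RdRegular 𝕋 A) (hAT : ∀ t ∈ 𝕋, A (t + T) = A t)
    (hY : IsLinearSolution 𝕋 A Y) (hYu : ∀ t ∈ 𝕋, IsUnit (Y t).det) {t₀ : ℝ} (ht₀ : t₀ ∈ 𝕋)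
    (hY1 : Y t₀ = 1) {t : ℝ} (ht : t ∈ 𝕋) (n : ℕ) : Y (t + n * T) = Y t * Y (t₀ + T) ^ n := by
  induction n with
  | zero => simp
  | succ n ih =>
    rw [show t + ((n + 1 : ℕ) : ℝ) * T = t + n * T + T by push_cast; ring,
      hY.floquet h hT hA hAT hYu ht₀ hY1 (hT.add_nat_mul_mem ht n), ih, mul_assoc, ← pow_succ]

/-- If the powers of the monodromy matrix are bounded, so is `Y` on each half-line `[s, ∞)`. -/
lemma IsLinearSolution.exists_bound (h : IsTimeScale 𝕋) (hT : IsPeriodic 𝕋 T)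
    {A Y : ℝ → Matrix (Fin 2) (Fin 2) ℝ} {M : Matrix (Fin 2) (Fin 2) ℝ}
    (hY : IsLinearSolution 𝕋 A Y) (hM : ∀ t ∈ 𝕋, ∀ n : ℕ, Y (t + n * T) = Y t * M ^ n)
    (hMb : ∃ C : ℝ, ∀ n i j, |(M ^ n) i j| ≤ C) {s : ℝ} (hs : s ∈ 𝕋) :
    ∃ C : ℝ, ∀ t ∈ 𝕋, s ≤ t → ∀ i j, |Y t i j| ≤ C := by
  have hu := hT.nonempty_inter_Ioi h
  obtain ⟨C, hC⟩ := hMb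
  have hcont : ∀ i j, ContinuousOn (fun t => Y t i j) 𝕋 := fun i j =>
    (entryCLM i j).continuous.comp_continuousOn (hY.continuousOn hu)
  have hloc : ∀ i j, ∃ K : ℝ, 0 < K ∧ ∀ t ∈ 𝕋, s ≤ t → t ≤ s + T → ‖Y t i j‖ ≤ K := fun i j =>
    (rdRegular_of_continuousOn (hcont i j)).exists_bound h.isClosed s (s + T)
  choose K hK0 hK using hloc
  have hC0 : 0 ≤ C := (abs_nonneg _).trans (hC 0 0 0)
  refine ⟨(∑ i, ∑ j, K i j) * C, fun t ht hst i j => ?_⟩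
  obtain ⟨r, hr, hsr, hrs, n, rfl⟩ := hT.exists_eq_add h hs ht hst
  rw [hM r hr n, Matrix.mul_apply]
  calc |∑ k, Y r i k * (M ^ n) k j| ≤ ∑ k, |Y r i k * (M ^ n) k j| :=
        Finset.abs_sum_le_sum_abs _ _
    _ ≤ ∑ k, K i k * C := by
        gcongr with k
        rw [abs_mul]
        exact mul_le_mul (hK i k r hr hsr hrs) (hC n k j) (abs_nonneg _) (hK0 i k).le
    _ = (∑ k, K i k) * C := by rw [Finset.sum_mul]
    _ ≤ _ := by
        refine mul_le_mul_of_nonneg_right ?_ hC0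
        exact Finset.single_le_sum (f := fun i => ∑ j, K i j)
          (fun i _ => Finset.sum_nonneg fun j _ => (hK0 i j).le) (Finset.mem_univ i)

/-- Stability follows from boundedness of one invertible matrix solution. -/
lemma isStable_of_bounded (h : IsTimeScale 𝕋) (hu : ∀ t, (𝕋 ∩ Ioi t).Nonempty)
    (hA : RdRegular 𝕋 (coeffMatrix p q)) {Y : ℝ → Matrix (Fin 2) (Fin 2) ℝ}
    (hY : IsLinearSolution 𝕋 (coeffMatrix p q) Y) (hYu : ∀ t ∈ 𝕋, IsUnit (Y t).det)
    (hb : ∀ s ∈ 𝕋, ∃ C : ℝ, ∀ t ∈ 𝕋, s ≤ t → ∀ i j, |Y t i j| ≤ C) : IsStable 𝕋 p q := by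
  intro s hs ε hε
  obtain ⟨C, hC⟩ := hb s hs
  have hC0 : 0 ≤ C := (abs_nonneg _).trans (hC s hs le_rfl 0 0)
  -- `D` bounds the entries of `Y(s)⁻¹`
  set D := ∑ i, ∑ j, |(Y s)⁻¹ i j| with hD
  have hDle : ∀ i j, |(Y s)⁻¹ i j| ≤ D := fun i j =>
    (Finset.single_le_sum (f := fun j => |(Y s)⁻¹ i j|) (fun j _ => abs_nonneg _)
      (Finset.mem_univ j)).trans
    (Finset.single_le_sum (f := fun i => ∑ j, |(Y s)⁻¹ i j|)
      (fun i _ => Finset.sum_nonneg fun j _ => abs_nonneg _) (Finset.mem_univ i))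
  have hD0 : 0 ≤ D := (abs_nonneg _).trans (hDle 0 0)
  refine ⟨ε / (4 * C * D + 1), by positivity, fun x y hxy hx hy t ht hst => ?_⟩
  set δ := ε / (4 * C * D + 1) with hδ
  have hδ0 : 0 < δ := by positivity
  have hV := hY.eq_mul_inv_mul h hu hA hxy.isLinearSolution hs ht hst (hYu s hs)
  have hw : ∀ k, |((Y s)⁻¹ * !![x s, 0; y s, 0]) k 0| ≤ 2 * D * δ := fun k => by
    rw [Matrix.mul_apply, Fin.sum_univ_two]
    have h1 : |(Y s)⁻¹ k 0 * x s| ≤ D * δ := by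
      rw [abs_mul]; exact mul_le_mul (hDle k 0) hx.le (abs_nonneg _) hD0
    have h2 : |(Y s)⁻¹ k 1 * y s| ≤ D * δ := by
      rw [abs_mul]; exact mul_le_mul (hDle k 1) hy.le (abs_nonneg _) hD0
    have h3 := abs_add_le ((Y s)⁻¹ k 0 * x s) ((Y s)⁻¹ k 1 * y s)
    simp only [Matrix.of_apply, Matrix.cons_val_zero, Matrix.cons_val_one]
    linarith
  have hfin : ∀ i, |(!![x t, 0; y t, 0] : Matrix (Fin 2) (Fin 2) ℝ) i 0| < ε := fun i => by
    rw [hV, Matrix.mul_apply, Fin.sum_univ_two]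
    have h1 : ∀ k, |Y t i k * ((Y s)⁻¹ * !![x s, 0; y s, 0]) k 0| ≤ C * (2 * D * δ) := fun k => by
      rw [abs_mul]; exact mul_le_mul (hC t ht hst i k) (hw k) (abs_nonneg _) hC0
    have h2 : δ * (4 * C * D + 1) = ε := by rw [hδ]; field_simp
    exact (abs_add_le _ _).trans_lt (by linarith [h1 0, h1 1])
  exact ⟨hfin 0, hfin 1⟩

/-- Under stability, the columns of `Y` are bounded, and with them the powers of the monodromy
matrix. -/
lemma IsStable.exists_bound_pow (hT : IsPeriodic 𝕋 T) (hst : IsStable 𝕋 p q)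
    {Y : ℝ → Matrix (Fin 2) (Fin 2) ℝ} {M : Matrix (Fin 2) (Fin 2) ℝ} {t₀ : ℝ} (ht₀ : t₀ ∈ 𝕋)
    (hY : IsLinearSolution 𝕋 (coeffMatrix p q) Y) (hY1 : Y t₀ = 1)
    (hM : ∀ n : ℕ, Y (t₀ + n * T) = M ^ n) : ∃ C : ℝ, ∀ n i j, |(M ^ n) i j| ≤ C := by
  obtain ⟨δ, hδ, H⟩ := hst t₀ ht₀ 1 one_pos
  refine ⟨2 / δ, fun n i j => ?_⟩
  have hentry : ∀ i j : Fin 2, |δ / 2 * (1 : Matrix (Fin 2) (Fin 2) ℝ) i j| < δ := fun i j => by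
    rw [Matrix.one_apply]
    split_ifs
    · rw [mul_one, abs_of_pos (by positivity)]; linarith
    · simpa using hδ
  have hpos := hT.pos
  have h1 := H _ _ (hY.isSolution j (δ / 2)) (by rw [hY1]; exact hentry 0 j)
    (by rw [hY1]; exact hentry 1 j) _ (hT.add_nat_mul_mem ht₀ n)
    (le_add_of_nonneg_right (by positivity))
  rw [hM n] at h1
  have h2 : |δ / 2 * (M ^ n) i j| < 1 := by
    fin_cases i
    · exact h1.1
    · exact h1.2
  rw [abs_mul, abs_of_pos (by positivity)] at h2
  rw [le_div_iff₀ hδ]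
  linarith

end

end TimeScale

theorem theorem3p2 (𝕋 : Set ℝ) (T : ℝ) (p q : ℝ → ℝ) (t₀ : ℝ)
    (h𝕋 : TimeScale.IsTimeScale 𝕋) (hT : TimeScale.IsPeriodic 𝕋 T)
    (hpq : TimeScale.Admissible 𝕋 T p q) (ht₀ : t₀ ∈ 𝕋)
    (hB : TimeScale.calB 𝕋 T p q t₀ = 1) :
    (|TimeScale.calA 𝕋 T p q t₀| < 2 →
      TimeScale.IsStable 𝕋 p q ∧
      ∃ ρ₁ ρ₂ : ℂ, TimeScale.multipliers 𝕋 T p q t₀ = {ρ₁, ρ₂} ∧ ρ₁ ≠ ρ₂ ∧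
        ‖ρ₁‖ = 1 ∧ ‖ρ₂‖ = 1) ∧
    (2 < |TimeScale.calA 𝕋 T p q t₀| → TimeScale.IsUnstable 𝕋 p q) := by
  open TimeScale in
  have hu := hT.nonempty_inter_Ioi h𝕋
  have hp := hpq.rdContinuous_p.rdRegular hu
  have hq := hpq.rdContinuous_q.rdRegular hu
  have hA := rdRegular_coeffMatrix hp hq
  have hAT : ∀ t ∈ 𝕋, coeffMatrix p q (t + T) = coeffMatrix p q t := fun t ht => by
    rw [coeffMatrix, hpq.periodic_p t ht, hpq.periodic_q t ht, coeffMatrix]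
  have hex := exists_principalMatrix h𝕋 hu hp hq hpq.regressive ht₀
  obtain ⟨Y, hYP, hΦ⟩ : ∃ Y, IsPrincipalMatrix 𝕋 (coeffMatrix p q) t₀ Y ∧
      ∀ t, transitionMatrix 𝕋 (coeffMatrix p q) t t₀ = Y t :=
    ⟨hex.choose, hex.choose_spec, fun t => by rw [transitionMatrix, dif_pos hex]⟩
  obtain ⟨hY1, hY⟩ := isPrincipalMatrix_iff.1 hYP
  have hYu : ∀ t ∈ 𝕋, IsUnit (Y t).det := fun t ht =>
    hY.isUnit h𝕋 hu hp hq hpq.regressive ht₀ hY1 ht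
  have hfl : ∀ t ∈ 𝕋, ∀ n : ℕ, Y (t + n * T) = Y t * Y (t₀ + T) ^ n := fun t ht n =>
    hY.floquet_nat h𝕋 hT hA hAT hYu ht₀ hY1 ht n
  have hdet : (Y (t₀ + T)).det = 1 := by
    have h1 := ofReal_det_eq h𝕋 hu hp hq hpq.regressive ht₀ (hT.add_mem t₀ ht₀)
      (le_add_of_nonneg_right hT.pos.le) (hY.inter_Ici hu t₀)
    rw [hY1, Matrix.det_one, Complex.ofReal_one, mul_one] at h1
    exact_mod_cast h1.trans hB
  have htr : calA 𝕋 T p q t₀ = (Y (t₀ + T)).trace := by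
    rw [calA, hΦ, Matrix.trace_fin_two]
  rw [htr, multipliers, hΦ]
  refine ⟨fun hlt => ⟨?_, spectrum_of_det_eq_one hdet hlt⟩, fun hgt hst => ?_⟩
  · exact isStable_of_bounded h𝕋 hu hA hY hYu fun s hs =>
      hY.exists_bound h𝕋 hT hfl (exists_bound_pow hdet hlt) hs
  · exact not_bounded_pow hdet hgt (hst.exists_bound_pow hT ht₀ hY hY1 fun n => by
      rw [hfl t₀ ht₀ n, hY1, one_mul])
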